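/- Let $B_1$ and $B_2$ be separable unital $C^*$-algebras, both containing $D=\mathbb{C}^2$ as a unital $C^*$-subalgebra, and let $p,q$ be the two minimal projections of $D$. Suppose that for $i=1,2$ there is a faithful (non-normalized) positive trace $\operatorname{tr}_i$ on $B_i$ with $\operatorname{tr}_i(p)=1=\operatorname{tr}_i(q)$ (so that $\operatorname{tr}_1$ and $\operatorname{tr}_2$ agree on $D$), and a trace-preserving conditional expectation $E_i\colon B_i\to D$. Let $$(B,E)=(B_1,E_1)\underset{D}{*}(B_2,E_2)$$ be the reduced amalgamated free product: up to isomorphism, the unital $C^*$-algebra $B$ generated by copies of $B_1$ and $B_2$ that coincide on $D$, with a conditional expectation $E\colon B\to D$ extending $E_1$ and $E_2$ such that $B_1$ and $B_2$ are free over $D$ with respect to $E$ (that is, $E$ vanishes on every nonempty alternating product of elements of $\ker E_1$ and $\ker E_2$), and such that the representation of $B$ on the Hilbert $D$-module $L^2(B,E)$ is faithful. Suppose that there are unitaries $u_1\in B_1$ and $u_2,u_2'\in B_2$ with $v=pvp+qvq$ for each $v\in\{u_1,u_2,u_2'\}$, and $$E(u_1)=E(u_2)=E(u_2')=E(u_2^*u_2')=0.$$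 Then $pBp$ and $qBq$ both have stable rank $1$: the invertible elements of $pBp$ (with unit $p$) are norm dense in $pBp$, and likewise for $qBq$. -/

import Mathlib

open scoped ComplexOrder InnerProductSpace

namespace AmalgFree

/-- A unital (topological) algebra has stable rank one if its invertible elements are dense. -/
def HasStableRankOne (A : Type*) [Ring A] [TopologicalSpace A] : Prop :=
  Dense {a : A | IsUnit a}

/-- The corner `e A e` (a ring with unit `e`) carries the topology inherited from `A`. -/
instance cornerTopology {A : Type*} [NonUnitalRing A] [TopologicalSpace A] {e : A}
    (he : IsIdempotentElem e) : TopologicalSpace he.Corner :=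
  TopologicalSpace.induced (fun x : he.Corner => x.1) inferInstance

/-- A faithful, not necessarily normalized, bounded positive trace on a C⋆-algebra (a positive
linear functional is automatically bounded). -/
structure IsFaithfulTrace {B : Type*} [CStarAlgebra B] (tr : B →ₗ[ℂ] ℂ) : Prop where
  tracial : ∀ a b, tr (a * b) = tr (b * a)
  nonneg : ∀ a, 0 ≤ tr (star a * a)
  faithful : ∀ a, tr (star a * a) = 0 → a = 0

/-- `E : B → D` is a conditional expectation onto the unital C⋆-subalgebra `ι(D) ≃ D` of `B`:
a positive `D`-bimodule map which restricts to the identity on `D`.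
(In a C⋆-algebra the positive elements are exactly those of the form `star c * c`.) -/
structure IsConditionalExpectation {D B : Type*} [CStarAlgebra D] [CStarAlgebra B]
    (ι : D →⋆ₐ[ℂ] B) (E : B →ₗ[ℂ] D) : Prop where
  apply_incl : ∀ d, E (ι d) = d
  bimodule : ∀ d b d', E (ι d * b * ι d') = d * E b * d'
  positive : ∀ b, ∃ c, E (star b * b) = star c * c

/-- `(A, EA)` is the reduced amalgamated free product over `D` of the family `(B i, E i)`, where
`D` sits in `B i` through `ι i`, in `A` through `κ`, and `B i` is mapped to `A` by `j i`:

* the `j i` agree on `D`;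
* `EA` is a conditional expectation of `A` onto `D` extending the `E i`;
* (freeness over `D`) `EA` kills every nonempty alternating product of elements of the `B i`
  with zero expectation;
* `A` is generated as a C⋆-algebra by the images of the `B i` (and `D`);
* the representation of `A` on the Hilbert `D`-module `L²(A, EA)` is faithful.

This determines `(A, EA, j)` up to a unique isomorphism.  For `D = ℂᴷ`, `K` finite, existence is
proved in `exists_isReducedAmalgamatedFreeProduct`. -/
structure IsReducedAmalgamatedFreeProduct {I D A : Type*} {B : I → Type*}
    [CStarAlgebra D] [∀ i, CStarAlgebra (B i)] [CStarAlgebra A]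
    (ι : ∀ i, D →⋆ₐ[ℂ] B i) (E : ∀ i, B i →ₗ[ℂ] D)
    (κ : D →⋆ₐ[ℂ] A) (j : ∀ i, B i →⋆ₐ[ℂ] A) (EA : A →ₗ[ℂ] D) : Prop where
  agree : ∀ i d, j i (ι i d) = κ d
  condExp : IsConditionalExpectation κ EA
  extends_expectation : ∀ i b, EA (j i b) = E i b
  free : ∀ l : List (Σ i, B i), l ≠ [] → l.IsChain (fun x y => x.1 ≠ y.1) →
    (∀ x ∈ l, E x.1 x.2 = 0) → EA (l.map fun x => j x.1 x.2).prod = 0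
  generates : (StarAlgebra.adjoin ℂ
    (Set.range κ ∪ ⋃ i, Set.range (j i))).topologicalClosure = ⊤
  faithful : ∀ a, (∀ x, EA (star (a * x) * (a * x)) = 0) → a = 0

/-- The minimal projections of `D = ℂ²`, i.e. `(1, 0)` for `k = 0` and `(0, 1)` for `k = 1`. -/
def minProj (k : Fin 2) : Fin 2 → ℂ := Pi.single k 1

theorem isIdempotentElem_minProj {A : Type*} [CStarAlgebra A] (κ : (Fin 2 → ℂ) →⋆ₐ[ℂ] A)
    (k : Fin 2) : IsIdempotentElem (κ (minProj k)) := by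
  unfold IsIdempotentElem minProj
  rw [← map_mul, ← Pi.single_mul, one_mul]

/-- For `D = ℂ²` sitting in `A` through `κ`: the corner `e A e` of a minimal projection `e` of `D`,
a ring with unit `e`. -/
abbrev minCorner {A : Type*} [CStarAlgebra A] (κ : (Fin 2 → ℂ) →⋆ₐ[ℂ] A) (k : Fin 2) : Type _ :=
  (isIdempotentElem_minProj κ k).Corner

end AmalgFree

/-! The rest of this file proves that reduced amalgamated free products over `ℂᴷ` exist, by
letting the algebras act on the free product Hilbert space. -/

namespace AmalgFree

section DirectSum

variable {B : Type*} [CStarAlgebra B] {W : Type*} {G : W → Type*}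
  [∀ w, NormedAddCommGroup (G w)] [∀ w, InnerProductSpace ℂ (G w)] [∀ w, CompleteSpace (G w)]

theorem dsAux_le (π : ∀ w, B →⋆ₐ[ℂ] (G w →L[ℂ] G w)) (b : B) (f : lp G 2) (w : W) :
    ‖π w b (f w)‖ ≤ ‖b‖ * ‖f w‖ :=
  ((π w b).le_opNorm _).trans
    (mul_le_mul_of_nonneg_right (NonUnitalStarAlgHom.norm_apply_le (π w) b) (norm_nonneg _))

theorem dsAux_summable (π : ∀ w, B →⋆ₐ[ℂ] (G w →L[ℂ] G w)) (b : B) (f : lp G 2) :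
    Summable fun w => ‖π w b (f w)‖ ^ (2 : ENNReal).toReal := by
  have hf := ((lp.memℓp f).summable (by norm_num)).mul_left (‖b‖ ^ (2 : ENNReal).toReal)
  refine Summable.of_nonneg_of_le (fun w => by positivity) (fun w => ?_) hf
  rw [← Real.mul_rpow (norm_nonneg _) (norm_nonneg _)]
  exact Real.rpow_le_rpow (norm_nonneg _) (dsAux_le π b f w) (by norm_num)

/-- The direct sum of a family of representations, on the `ℓ²`-direct sum. -/
noncomputable def dsMap (π : ∀ w, B →⋆ₐ[ℂ] (G w →L[ℂ] G w)) (b : B) : lp G 2 →L[ℂ] lp G 2 :=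
  LinearMap.mkContinuous
    { toFun := fun f => ⟨fun w => π w b (f w), memℓp_gen (dsAux_summable π b f)⟩
      map_add' := fun f g => by ext w; simp; rfl
      map_smul' := fun c f => by ext w; simp }
    ‖b‖ (fun f => by
      refine lp.norm_le_of_tsum_le (by norm_num) (by positivity) ?_
      rw [Real.mul_rpow (norm_nonneg _) (norm_nonneg _), lp.norm_rpow_eq_tsum (by norm_num),
        ← tsum_mul_left]
      refine Summable.tsum_le_tsum (fun w => ?_) (dsAux_summable π b f)
        (((lp.memℓp f).summable (by norm_num)).mul_left _)
      rw [← Real.mul_rpow (norm_nonneg _) (norm_nonneg _)]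
      exact Real.rpow_le_rpow (norm_nonneg _) (dsAux_le π b f w) (by norm_num))

theorem dsMap_apply (π : ∀ w, B →⋆ₐ[ℂ] (G w →L[ℂ] G w)) (b : B) (f : lp G 2) (w : W) :
    dsMap π b f w = π w b (f w) := rfl

noncomputable def dsRep (π : ∀ w, B →⋆ₐ[ℂ] (G w →L[ℂ] G w)) :
    B →⋆ₐ[ℂ] (lp G 2 →L[ℂ] lp G 2) where
  toFun := dsMap π
  map_one' := by ext f w; simp [dsMap_apply]
  map_mul' a b := by ext f w; simp [dsMap_apply]
  map_zero' := by ext f w; simp [dsMap_apply]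
  map_add' a b := by ext f w; simp [dsMap_apply]
  commutes' r := by ext f w; simp [dsMap_apply, Algebra.algebraMap_eq_smul_one]
  map_star' b := by
    rw [ContinuousLinearMap.star_eq_adjoint, ContinuousLinearMap.eq_adjoint_iff]
    intro f g
    rw [lp.inner_eq_tsum, lp.inner_eq_tsum]
    refine tsum_congr fun w => ?_
    rw [dsMap_apply, dsMap_apply, map_star, ContinuousLinearMap.star_eq_adjoint,
      ContinuousLinearMap.adjoint_inner_left]

theorem dsRep_single [DecidableEq W] (π : ∀ w, B →⋆ₐ[ℂ] (G w →L[ℂ] G w)) (b : B) (w : W)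
    (x : G w) : dsRep π b (lp.single 2 w x) = lp.single 2 w (π w b x) := by
  ext w'
  change π w' b (lp.single 2 w x w') = _
  by_cases h : w' = w
  · subst h; simp
  · rw [lp.single_apply_ne _ _ _ h, lp.single_apply_ne _ _ _ h, map_zero]

/-- Hilbert bases of the summands give a Hilbert basis of the direct sum. -/
noncomputable def dsBasis [DecidableEq W] {J : W → Type*}
    (bas : ∀ w, HilbertBasis (J w) ℂ (G w)) : HilbertBasis (Σ w, J w) ℂ (lp G 2) :=
  HilbertBasis.mkOfOrthogonalEqBot
    (v := fun s : (Σ w, J w) => lp.single 2 s.1 (bas s.1 s.2))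
    (by
      classical
      rw [orthonormal_iff_ite]
      rintro ⟨w, x⟩ ⟨w', x'⟩
      rw [lp.inner_single_left]
      by_cases h : w = w'
      · subst h
        simp only [lp.single_apply_self]
        rw [orthonormal_iff_ite.1 (bas w).orthonormal]
        simp
      · rw [lp.single_apply_ne _ _ _ h, inner_zero_right, if_neg]
        rintro ⟨⟩
        exact h rfl)
    (by
      rw [Submodule.eq_bot_iff]
      intro f hf
      rw [Submodule.mem_orthogonal] at hf
      ext w
      refine (bas w).repr.injective ?_
      ext x
      rw [HilbertBasis.repr_apply_apply]
      have := hf _ (Submodule.subset_span ⟨⟨w, x⟩, rfl⟩)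
      rw [lp.inner_single_left] at this
      simp [this])

theorem dsBasis_apply [DecidableEq W] {J : W → Type*}
    (bas : ∀ w, HilbertBasis (J w) ℂ (G w)) (s : Σ w, J w) :
    dsBasis bas s = lp.single 2 s.1 (bas s.1 s.2) := by
  simp [dsBasis]

end DirectSum

/-- The standard basis vectors of `ℓ²(Y)`. -/
noncomputable def delta {Y : Type*} : HilbertBasis Y ℂ (lp (fun _ : Y => ℂ) 2) :=
  HilbertBasis.ofRepr (LinearIsometryEquiv.refl ℂ (lp (fun _ : Y => ℂ) 2))

/-- The standard basis of `ℓ²(Y)`, reindexed along a bijection. -/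
noncomputable def stdBasis {Y S : Type*} (e : S ≃ Y) :
    HilbertBasis S ℂ (lp (fun _ : Y => ℂ) 2) :=
  HilbertBasis.mkOfOrthogonalEqBot (v := fun s => delta (e s))
    ((HilbertBasis.orthonormal _).comp _ e.injective)
    (by
      rw [Submodule.eq_bot_iff]
      intro f hf
      rw [Submodule.mem_orthogonal] at hf
      refine delta.repr.injective ?_
      ext y
      obtain ⟨s, rfl⟩ := e.surjective y
      rw [HilbertBasis.repr_apply_apply, hf _ (Submodule.subset_span ⟨s, rfl⟩)]
      simp)

theorem stdBasis_apply {Y S : Type*} (e : S ≃ Y) (s : S) : stdBasis e s = delta (e s) := by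
  simp [stdBasis]

end AmalgFree

namespace AmalgFree

section Fock

universe w

variable {I K : Type} {B : I → Type w} [∀ i, CStarAlgebra (B i)]

/-- For each `i` and `k`: the summand `G i k = L²(B i, E i) e_k` of the Hilbert `ℂᴷ`-module
`L²(B i, E i)`, with a Hilbert basis consisting of the vacuum vector (`none`) and of
eigenvectors `bas i k (some x)` of the left action of `ℂᴷ`, supported under `e_(lab i k x)`. -/
structure FockData [Fintype K] (ι : ∀ i, (K → ℂ) →⋆ₐ[ℂ] B i) (E : ∀ i, B i →ₗ[ℂ] (K → ℂ)) where
  G : I → K → Type w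
  [nacg : ∀ i k, NormedAddCommGroup (G i k)]
  [ips : ∀ i k, InnerProductSpace ℂ (G i k)]
  [cpl : ∀ i k, CompleteSpace (G i k)]
  π : ∀ i k, B i →⋆ₐ[ℂ] (G i k →L[ℂ] G i k)
  L : I → K → Type w
  lab : ∀ i k, L i k → K
  bas : ∀ i k, HilbertBasis (Option (L i k)) ℂ (G i k)
  expect : ∀ i k b, ⟪bas i k none, π i k b (bas i k none)⟫_ℂ = E i b k
  cyclic : ∀ i k, DenseRange fun b => π i k b (bas i k none)
  diag_none : ∀ i k d, π i k (ι i d) (bas i k none) = d k • bas i k none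
  diag_some : ∀ i k d x, π i k (ι i d) (bas i k (some x)) = d (lab i k x) • bas i k (some x)

attribute [instance] FockData.nacg FockData.ips FockData.cpl

variable [Fintype K] {ι : ∀ i, (K → ℂ) →⋆ₐ[ℂ] B i} {E : ∀ i, B i →ₗ[ℂ] (K → ℂ)}

/-- Composable alternating words; indexed by the algebra of the first letter and the left
support. -/
inductive Word (F : FockData ι E) : Option I → K → Type w
  | nil (k : K) : Word F none k
  | cons {o : Option I} {i : I} {k l : K} (h : o ≠ some i) (x : F.L i k)
      (hl : F.lab i k x = l) (v : Word F o k) : Word F (some i) l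

abbrev Words (F : FockData ι E) : Type w := Σ (o : Option I) (k : K), Word F o k

/-- Words not starting with a letter from `B i`. -/
abbrev Away (F : FockData ι E) (i : I) : Type w := {y : Words F // y.1 ≠ some i}

/-- The free product Hilbert space. -/
abbrev Fock (F : FockData ι E) : Type w := lp (fun _ : Words F => ℂ) 2

def attach (F : FockData ι E) (i : I) : (Σ y : Away F i, Option (F.L i y.1.2.1)) → Words F
  | ⟨y, none⟩ => y.1
  | ⟨y, some x⟩ => ⟨some i, F.lab i _ x, Word.cons y.2 x rfl y.1.2.2⟩

open Classical in
noncomputable def detach (F : FockData ι E) (i : I) :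
    Words F → (Σ y : Away F i, Option (F.L i y.1.2.1))
  | ⟨_, _, Word.nil k⟩ => ⟨⟨⟨none, k, Word.nil k⟩, by simp⟩, none⟩
  | ⟨_, _, Word.cons (o := o) (i := i') (k := k) (l := l) h x hl v⟩ =>
      if hi : i' = i then ⟨⟨⟨o, k, v⟩, hi ▸ h⟩, some (hi ▸ x)⟩
      else ⟨⟨⟨some i', l, Word.cons h x hl v⟩, by simpa using hi⟩, none⟩

theorem detach_attach (F : FockData ι E) (i : I) (s) : detach F i (attach F i s) = s := by
  obtain ⟨⟨⟨o, k, v⟩, hy⟩, x⟩ := s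
  cases x with
  | none =>
    cases v with
    | nil k => rfl
    | cons h x hl v =>
      simp only [attach, detach]
      rw [dif_neg]
      simpa using hy
  | some x => simp [attach, detach]

theorem attach_surjective (F : FockData ι E) (i : I) : Function.Surjective (attach F i) := by
  rintro ⟨o, k, v⟩
  by_cases h : o = some i
  · cases v with
    | nil k => simp at h
    | cons h' x hl v =>
      simp only [Option.some.injEq] at h
      subst h hl
      exact ⟨⟨⟨⟨_, _, v⟩, h'⟩, some x⟩, rfl⟩
  · exact ⟨⟨⟨⟨o, k, v⟩, h⟩, none⟩, rfl⟩

noncomputable def attachEquiv (F : FockData ι E) (i : I) :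
    (Σ y : Away F i, Option (F.L i y.1.2.1)) ≃ Words F :=
  Equiv.ofBijective (attach F i)
    ⟨Function.LeftInverse.injective (detach_attach F i), attach_surjective F i⟩

open Classical in
/-- `⨁_y L²(B i, E i) e_(label y) ≃ Fock`, the sum over the words not starting with `i`. -/
noncomputable def glue (F : FockData ι E) (i : I) :
    lp (fun y : Away F i => F.G i y.1.2.1) 2 ≃ₗᵢ[ℂ] Fock F :=
  (dsBasis fun y : Away F i => F.bas i y.1.2.1).repr.trans (stdBasis (attachEquiv F i)).repr.symm

open Classical in
theorem glue_single (F : FockData ι E) (i : I) (y : Away F i) (x : Option (F.L i y.1.2.1)) :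
    glue F i (lp.single 2 y (F.bas i _ x)) = delta (attach F i ⟨y, x⟩) := by
  have h : lp.single 2 y (F.bas i _ x) = dsBasis (fun y : Away F i => F.bas i y.1.2.1) ⟨y, x⟩ := by
    rw [dsBasis_apply]
  rw [h, glue, LinearIsometryEquiv.trans_apply, HilbertBasis.repr_self,
    HilbertBasis.repr_symm_single, stdBasis_apply]
  rfl

/-- The left action of `B i` on the free product Hilbert space. -/
noncomputable def lam (F : FockData ι E) (i : I) : B i →⋆ₐ[ℂ] (Fock F →L[ℂ] Fock F) :=
  (StarAlgHomClass.toStarAlgHom (glue F i).conjStarAlgEquiv).comp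
    (dsRep fun y : Away F i => F.π i y.1.2.1)

open Classical in
theorem lam_glue_single (F : FockData ι E) (i : I) (b : B i) (y : Away F i)
    (g : F.G i y.1.2.1) :
    lam F i b (glue F i (lp.single 2 y g)) = glue F i (lp.single 2 y (F.π i _ b g)) := by
  change glue F i (dsRep _ b ((glue F i).symm _)) = _
  rw [LinearIsometryEquiv.symm_apply_apply, dsRep_single]

open Classical in
theorem lam_delta (F : FockData ι E) (i : I) (b : B i) (y : Away F i) :
    lam F i b (delta y.1) = glue F i (lp.single 2 y (F.π i _ b (F.bas i _ none))) := by
  rw [← lam_glue_single, glue_single]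
  rfl

theorem lam_incl_delta (F : FockData ι E) (i : I) (d : K → ℂ) (y : Words F) :
    lam F i (ι i d) (delta y) = d y.2.1 • delta y := by
  classical
  obtain ⟨⟨y, x⟩, rfl⟩ := attach_surjective F i y
  rw [← glue_single, lam_glue_single]
  cases x with
  | none => rw [F.diag_none, lp.single_smul, map_smul]; rfl
  | some x => rw [F.diag_some, lp.single_smul, map_smul]; rfl

theorem lam_incl_eq (F : FockData ι E) (i i' : I) (d : K → ℂ) :
    lam F i (ι i d) = lam F i' (ι i' d) := by
  refine ContinuousLinearMap.ext_on (s := Set.range (delta (Y := Words F))) ?_ ?_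
  · rw [Submodule.dense_iff_topologicalClosure_eq_top]
    exact delta.dense_span
  · rintro _ ⟨y, rfl⟩
    rw [lam_incl_delta, lam_incl_delta]

/-- The vacuum vectors. -/
noncomputable def vac (F : FockData ι E) (k : K) : Fock F := delta ⟨none, k, Word.nil k⟩

/-- The vacuum expectation. -/
noncomputable def vacExp (F : FockData ι E) : (Fock F →L[ℂ] Fock F) →ₗ[ℂ] (K → ℂ) where
  toFun T k := ⟪vac F k, T (vac F k)⟫_ℂ
  map_add' S T := by ext k; simp
  map_smul' c T := by ext k; simp

theorem vacExp_lam (F : FockData ι E) (i : I) (b : B i) : vacExp F (lam F i b) = E i b := by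
  classical
  ext k
  have h1 := lam_delta F i b ⟨⟨none, k, Word.nil k⟩, by simp⟩
  have h2 := glue_single F i ⟨⟨none, k, Word.nil k⟩, by simp⟩ none
  change ⟪delta _, lam F i b (delta _)⟫_ℂ = _
  rw [h1]
  change glue F i _ = delta ⟨none, k, Word.nil k⟩ at h2
  rw [← h2, LinearIsometryEquiv.inner_map_map, lp.inner_single_left, lp.single_apply_self]
  exact F.expect i k b

theorem inner_lam_eq_zero (F : FockData ι E) (i : I) (b : B i) (hb : E i b = 0)
    (o : Option I) (ho : o ≠ some i) (v : Fock F)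
    (hv : ∀ y : Words F, y.1 ≠ o → ⟪delta y, v⟫_ℂ = 0) (y : Words F) (hy : y.1 ≠ some i) :
    ⟪delta y, lam F i b v⟫_ℂ = 0 := by
  classical
  have h1 : ⟪delta y, lam F i b v⟫_ℂ = ⟪lam F i (star b) (delta y), v⟫_ℂ := by
    rw [map_star, ContinuousLinearMap.star_eq_adjoint, ContinuousLinearMap.adjoint_inner_left]
  have h2 := lam_delta F i (star b) ⟨y, hy⟩
  simp only at h2
  rw [h1, h2]
  obtain ⟨f, rfl⟩ := (glue F i).surjective v
  rw [LinearIsometryEquiv.inner_map_map, lp.inner_single_left,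
    ← (F.bas i y.2.1).tsum_inner_mul_inner]
  refine (tsum_congr fun x => ?_).trans tsum_zero
  cases x with
  | none =>
    rw [map_star, ContinuousLinearMap.star_eq_adjoint, ContinuousLinearMap.adjoint_inner_left,
      F.expect, hb, Pi.zero_apply, zero_mul]
  | some x =>
    have h3 := hv (attach F i ⟨⟨y, hy⟩, some x⟩) (by simpa [attach] using ho.symm)
    rw [← glue_single, LinearIsometryEquiv.inner_map_map, lp.inner_single_left] at h3
    rw [h3, mul_zero]

theorem vacExp_free_aux (F : FockData ι E) (k : K) (l : List (Σ i, B i))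
    (hl : l.IsChain (fun x y => x.1 ≠ y.1)) (h0 : ∀ x ∈ l, E x.1 x.2 = 0)
    (y : Words F) (hy : y.1 ≠ l.head?.map Sigma.fst) :
    ⟪delta y, (l.map fun x => lam F x.1 x.2).prod (vac F k)⟫_ℂ = 0 := by
  induction l generalizing y with
  | nil =>
    simp only [List.map_nil, List.prod_nil, one_apply_eq_self]
    refine delta.orthonormal.inner_eq_zero ?_
    rintro rfl
    simp at hy
  | cons x l ih =>
    simp only [List.map_cons, List.prod_cons, mul_apply_eq_comp]
    refine inner_lam_eq_zero F x.1 x.2 (h0 x (by simp)) (l.head?.map Sigma.fst) ?_ _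
      (ih hl.of_cons fun z hz => h0 z (by simp [hz])) y (by simpa using hy)
    cases l with
    | nil => simp
    | cons z l =>
      simp only [List.head?_cons, Option.map_some, ne_eq, Option.some.injEq]
      exact fun h => (List.isChain_cons_cons.1 hl).1 h.symm

theorem eq_top_of_invariant (F : FockData ι E) (S : Submodule ℂ (Fock F))
    (hS : IsClosed (S : Set (Fock F))) (hvac : ∀ k, vac F k ∈ S)
    (hinv : ∀ i b, ∀ v ∈ S, lam F i b v ∈ S) : S = ⊤ := by
  classical
  have key : ∀ (o : Option I) (k : K) (v : Word F o k), delta ⟨o, k, v⟩ ∈ S := by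
    intro o k v
    induction v with
    | nil k => exact hvac k
    | @cons o i k l h x hl v ih =>
      subst hl
      have h1 : ∀ g : F.G i k, glue F i (lp.single 2 (⟨⟨o, k, v⟩, h⟩ : Away F i) g) ∈ S := by
        intro g
        refine (F.cyclic i k).induction_on (p := fun g =>
          glue F i (lp.single 2 (⟨⟨o, k, v⟩, h⟩ : Away F i) g) ∈ S) g ?_ ?_
        · exact hS.preimage ((glue F i).continuous.comp (lp.isometry_single (p := 2)
            (E := fun y : Away F i => F.G i y.1.2.1) ⟨⟨o, k, v⟩, h⟩).continuous)
        · intro b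
          have := hinv i b _ ih
          rwa [lam_delta F i b ⟨⟨o, k, v⟩, h⟩] at this
      have h2 := h1 (F.bas i k (some x))
      rwa [glue_single F i ⟨⟨o, k, v⟩, h⟩ (some x)] at h2
  rw [eq_top_iff, ← delta.dense_span]
  refine Submodule.topologicalClosure_minimal _ ?_ hS
  rw [Submodule.span_le]
  rintro _ ⟨⟨o, k, v⟩, rfl⟩
  exact key o k v

/-- The reduced amalgamated free product, as an algebra of operators on `Fock F`. -/
noncomputable def opAlg (F : FockData ι E) : StarSubalgebra ℂ (Fock F →L[ℂ] Fock F) :=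
  (StarAlgebra.adjoin ℂ (⋃ i, Set.range (lam F i))).topologicalClosure

instance opAlg_isClosed (F : FockData ι E) :
    IsClosed (opAlg F : Set (Fock F →L[ℂ] Fock F)) :=
  StarSubalgebra.isClosed_topologicalClosure _

theorem lam_mem (F : FockData ι E) (i : I) (b : B i) : lam F i b ∈ opAlg F :=
  StarSubalgebra.le_topologicalClosure _
    (StarAlgebra.subset_adjoin ℂ _ (Set.mem_iUnion.2 ⟨i, b, rfl⟩))

/-- The inclusion of `B i`. -/
noncomputable def incl (F : FockData ι E) (i : I) : B i →⋆ₐ[ℂ] opAlg F :=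
  StarAlgHom.codRestrict (lam F i) (opAlg F) (lam_mem F i)

/-- The conditional expectation of the free product. -/
noncomputable def opExp (F : FockData ι E) : opAlg F →ₗ[ℂ] (K → ℂ) :=
  (vacExp F).comp (opAlg F).subtype.toAlgHom.toLinearMap

theorem opExp_star_mul_self (F : FockData ι E) (T : opAlg F) (k : K) :
    opExp F (star T * T) k = ((‖T.1 (vac F k)‖ ^ 2 : ℝ) : ℂ) := by
  change ⟪vac F k, (star T.1 * T.1) (vac F k)⟫_ℂ = _
  rw [mul_apply_eq_comp, ContinuousLinearMap.star_eq_adjoint,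
    ContinuousLinearMap.adjoint_inner_right, inner_self_eq_norm_sq_to_K]
  simp

theorem opAlg_isReduced [Nonempty I] (F : FockData ι E)
    (hE : ∀ i, IsConditionalExpectation (ι i) (E i)) :
    IsReducedAmalgamatedFreeProduct ι E
      ((incl F (Classical.arbitrary I)).comp (ι (Classical.arbitrary I))) (incl F) (opExp F) where
  agree i d := Subtype.ext (lam_incl_eq F _ _ d)
  condExp :=
    { apply_incl := fun d => (vacExp_lam F _ _).trans ((hE _).apply_incl d)
      bimodule := by
        intro d T d'
        ext k
        change ⟪vac F k, (lam F _ (ι _ d) * T.1 * lam F _ (ι _ d')) (vac F k)⟫_ℂ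
          = d k * ⟪vac F k, T.1 (vac F k)⟫_ℂ * d' k
        have h (d : K → ℂ) : lam F (Classical.arbitrary I) (ι _ d) (vac F k) = d k • vac F k :=
          lam_incl_delta F _ d _
        rw [mul_apply_eq_comp, mul_apply_eq_comp, h, map_smul, map_smul,
          inner_smul_right, ← star_star d, map_star, map_star,
          ContinuousLinearMap.star_eq_adjoint, ContinuousLinearMap.adjoint_inner_right, h,
          inner_smul_left]
        simp only [Pi.star_apply, RCLike.star_def, Complex.conj_conj]
        ring
      positive := by
        intro T
        refine ⟨fun k => (‖T.1 (vac F k)‖ : ℂ), ?_⟩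
        ext k
        rw [opExp_star_mul_self]
        simp [sq] }
  extends_expectation i b := vacExp_lam F i b
  free l hne hl h0 := by
    ext k
    have h := vacExp_free_aux F k l hl h0 ⟨none, k, Word.nil k⟩ (by
      cases l with
      | nil => exact absurd rfl hne
      | cons x l => simp)
    have h' : ((l.map fun x => incl F x.1 x.2).prod : opAlg F).1
        = (l.map fun x => lam F x.1 x.2).prod := by
      clear hne hl h0 h
      induction l with
      | nil => rfl
      | cons x l ih =>
        rw [List.map_cons, List.prod_cons, List.map_cons, List.prod_cons, ← ih]
        rfl
    change ⟪vac F k, ((l.map fun x => incl F x.1 x.2).prod : opAlg F).1 (vac F k)⟫_ℂ = 0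
    rw [h']
    exact h
  generates := by
    rw [eq_top_iff]
    rintro T -
    rw [← SetLike.mem_coe, StarSubalgebra.topologicalClosure_coe, closure_subtype]
    have hT : T.1 ∈ closure (StarAlgebra.adjoin ℂ (⋃ i, Set.range (lam F i)) :
        Set (Fock F →L[ℂ] Fock F)) := T.2
    refine closure_mono ?_ hT
    intro S hS
    rw [SetLike.mem_coe] at hS
    have : StarAlgebra.adjoin ℂ (⋃ i, Set.range (lam F i)) ≤
        (StarAlgebra.adjoin ℂ (Set.range ((incl F (Classical.arbitrary I)).comp
          (ι (Classical.arbitrary I))) ∪ ⋃ i, Set.range (incl F i))).map (opAlg F).subtype := by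
      rw [StarAlgebra.adjoin_le_iff]
      rintro _ hx
      obtain ⟨i, b, rfl⟩ := Set.mem_iUnion.1 hx
      exact ⟨incl F i b, StarAlgebra.subset_adjoin ℂ _
        (Or.inr (Set.mem_iUnion.2 ⟨i, b, rfl⟩)), rfl⟩
    exact this hS
  faithful := by
    intro T hT
    let S : Submodule ℂ (Fock F) :=
      (Submodule.span ℂ {v | ∃ (x : opAlg F) (k : K), v = x.1 (vac F k)}).topologicalClosure
    have hS : S = ⊤ := by
      refine eq_top_of_invariant F S (Submodule.isClosed_topologicalClosure _) ?_ ?_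
      · intro k
        exact Submodule.le_topologicalClosure _ (Submodule.subset_span ⟨1, k, rfl⟩)
      · intro i b
        have : S ≤ S.comap (lam F i b).toLinearMap := by
          refine Submodule.topologicalClosure_minimal _ ?_
            ((Submodule.isClosed_topologicalClosure _).preimage (lam F i b).continuous)
          rw [Submodule.span_le]
          rintro _ ⟨x, k, rfl⟩
          exact Submodule.le_topologicalClosure _
            (Submodule.subset_span ⟨incl F i b * x, k, rfl⟩)
        exact fun v hv => this hv
    have hker : S ≤ T.1.ker := by
      refine Submodule.topologicalClosure_minimal _ ?_ T.1.isClosed_ker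
      rw [Submodule.span_le]
      rintro _ ⟨x, k, rfl⟩
      have h := congrFun (hT x) k
      rw [opExp_star_mul_self, Pi.zero_apply] at h
      have h2 : ‖(T * x).1 (vac F k)‖ ^ 2 = 0 := by exact_mod_cast h
      have h3 : (T * x).1 (vac F k) = 0 := by simpa using h2
      exact h3
    ext1
    ext1 v
    exact hker (hS ▸ Submodule.mem_top)

end Fock

end AmalgFree

namespace AmalgFree

universe u

theorem exists_gns {B : Type u} [CStarAlgebra B] (φ : B →ₗ[ℂ] ℂ)
    (hφ : ∀ b, 0 ≤ φ (star b * b)) :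
    ∃ (G : Type u) (_ : NormedAddCommGroup G) (_ : InnerProductSpace ℂ G) (_ : CompleteSpace G)
      (π : B →⋆ₐ[ℂ] (G →L[ℂ] G)) (ξ : G),
      (∀ b, ⟪ξ, π b ξ⟫_ℂ = φ b) ∧ DenseRange fun b => π b ξ := by
  let _ := CStarAlgebra.spectralOrder B
  have _ := CStarAlgebra.spectralOrderedRing B
  let f : B →ₚ[ℂ] ℂ := PositiveLinearMap.mk₀ φ (fun x hx => by
    obtain ⟨y, rfl⟩ := CStarAlgebra.nonneg_iff_eq_star_mul_self.1 hx
    exact hφ y)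
  have hπ : ∀ b, f.gnsStarAlgHom b ((f.toPreGNS 1 : f.PreGNS) : f.GNS)
      = ((f.toPreGNS b : f.PreGNS) : f.GNS) := by
    intro b
    exact (f.gnsNonUnitalStarAlgHom_apply_coe (a := b) (b := f.toPreGNS 1)).trans (by simp)
  refine ⟨f.GNS, inferInstance, inferInstance, inferInstance, f.gnsStarAlgHom,
    ((f.toPreGNS 1 : f.PreGNS) : f.GNS), ?_, ?_⟩
  · intro b
    rw [hπ, UniformSpace.Completion.inner_coe, PositiveLinearMap.preGNS_inner_def]
    simp only [PositiveLinearMap.ofPreGNS_toPreGNS, star_one, one_mul]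
    rfl
  · simp only [hπ]
    exact (UniformSpace.Completion.denseRange_coe).comp
      (f.toPreGNS.surjective.denseRange) (UniformSpace.Completion.continuous_coe _)

theorem exists_eigenbasis {K : Type} [Fintype K] {G : Type u} [NormedAddCommGroup G]
    [InnerProductSpace ℂ G] [CompleteSpace G] (ρ : (K → ℂ) →⋆ₐ[ℂ] (G →L[ℂ] G)) (ξ : G)
    (hξ : ⟪ξ, ξ⟫_ℂ = 1) (k : K) (hk : ∀ d, ρ d ξ = d k • ξ) :
    ∃ (L : Type u) (lab : L → K) (bas : HilbertBasis (Option L) ℂ G), bas none = ξ ∧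
      ∀ d x, ρ d (bas (some x)) = d (lab x) • bas (some x) := by
  classical
  let e : K → (K → ℂ) := fun l => Pi.single l 1
  have he : ∀ l, star (e l) = e l := fun l => by
    ext m; by_cases h : m = l
    · subst h; simp [e]
    · simp [e, h]
  have hadj : ∀ l x y, ⟪ρ (e l) x, y⟫_ℂ = ⟪x, ρ (e l) y⟫_ℂ := by
    intro l x y
    nth_rewrite 1 [← he l]
    rw [map_star, ContinuousLinearMap.star_eq_adjoint, ContinuousLinearMap.adjoint_inner_left]
  have hmul : ∀ d l, d * e l = d l • e l := fun d l => by
    ext m; by_cases h : m = l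
    · subst h; simp [e]
    · simp [e, h]
  let N : K → Submodule ℂ G := fun l => (ρ (e l) - 1).ker ⊓ (ℂ ∙ ξ)ᗮ
  have hN : ∀ l x, x ∈ N l ↔ ρ (e l) x = x ∧ ⟪ξ, x⟫_ℂ = 0 := by
    intro l x
    simp only [N, Submodule.mem_inf, Submodule.mem_orthogonal_singleton_iff_inner_right,
      LinearMap.mem_ker]
    rw [← sub_eq_zero (a := ρ (e l) x)]
    rfl
  have hNc : ∀ l, CompleteSpace (N l) := fun l =>
    ((ρ (e l) - 1).isClosed_ker.inter (ℂ ∙ ξ).isClosed_orthogonal).completeSpace_coe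
  choose w b hb using fun l => exists_hilbertBasis ℂ (N l)
  have hd : ∀ (l : K) (x : N l) (d : K → ℂ), ρ d x = d l • (x : G) := by
    intro l x d
    have hx := ((hN l x).1 x.2).1
    calc ρ d x = ρ d (ρ (e l) x) := by rw [hx]
      _ = ρ (d * e l) x := by rw [map_mul]; rfl
      _ = d l • ρ (e l) x := by rw [hmul, map_smul]; rfl
      _ = d l • (x : G) := by rw [hx]
  let v : Option (Σ l, w l) → G := fun o => o.elim ξ fun x => ((x.2 : N x.1) : G)
  have hv : Orthonormal ℂ v := by
    rw [orthonormal_iff_ite]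
    rintro (_ | ⟨l, x⟩) (_ | ⟨l', x'⟩)
    · simpa [v] using hξ
    · simpa [v] using ((hN l' _).1 (x' : N l').2).2
    · simpa [v] using inner_eq_zero_symm.1 ((hN l _).1 (x : N l).2).2
    · by_cases h : l = l'
      · subst h
        have := orthonormal_iff_ite.1 (b l).orthonormal x x'
        rw [hb] at this
        simpa [v] using this
      · rw [if_neg (by rintro ⟨⟩; exact h rfl)]
        change ⟪((x : N l) : G), ((x' : N l') : G)⟫_ℂ = 0
        have h1 := ((hN l _).1 (x : N l).2).1
        have h2 := hd l' x' (e l)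
        rw [← h1, hadj, h2]
        simp [e, Ne.symm h]
  refine ⟨Σ l, w l, fun x => x.1, HilbertBasis.mkOfOrthogonalEqBot hv ?_, ?_, ?_⟩
  · rw [Submodule.eq_bot_iff]
    intro y hy
    rw [Submodule.mem_orthogonal] at hy
    have h0 : ⟪ξ, y⟫_ℂ = 0 := hy _ (Submodule.subset_span ⟨none, rfl⟩)
    have hz : ∀ l, ρ (e l) y = 0 := by
      intro l
      have hmem : ρ (e l) y ∈ N l := by
        rw [hN]
        constructor
        · rw [← mul_apply_eq_comp, ← map_mul, hmul]
          simp [e]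
        · rw [← hadj, hk, inner_smul_left, h0, mul_zero]
      have : (⟨ρ (e l) y, hmem⟩ : N l) = 0 := by
        refine (b l).repr.injective ?_
        ext x
        rw [HilbertBasis.repr_apply_apply, hb]
        have h3 : ⟪((x : N l) : G), y⟫_ℂ = 0 := hy _ (Submodule.subset_span ⟨some ⟨l, x⟩, rfl⟩)
        have h4 : ⟪((x : N l) : G), ρ (e l) y⟫_ℂ = 0 := by
          rw [← hadj, ((hN l _).1 (x : N l).2).1, h3]
        simpa using h4
      simpa using congrArg Subtype.val this
    have hsum : (1 : K → ℂ) = ∑ l, e l := by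
      ext m
      simp [e, Finset.sum_apply, Pi.single_apply]
    calc y = ρ 1 y := by rw [map_one]; rfl
      _ = ∑ l, ρ (e l) y := by rw [hsum, map_sum, sum_apply]
      _ = 0 := Finset.sum_eq_zero fun l _ => hz l
  · rw [HilbertBasis.coe_mkOfOrthogonalEqBot]; rfl
  · intro d x
    rw [HilbertBasis.coe_mkOfOrthogonalEqBot]
    exact hd x.1 x.2 d

theorem exists_fockData {I K : Type} [Fintype K] {B : I → Type u} [∀ i, CStarAlgebra (B i)]
    (ι : ∀ i, (K → ℂ) →⋆ₐ[ℂ] B i) (E : ∀ i, B i →ₗ[ℂ] (K → ℂ))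
    (hE : ∀ i, IsConditionalExpectation (ι i) (E i)) : Nonempty (FockData ι E) := by
  have h1 (i : I) (k : K) := exists_gns ((LinearMap.proj k : (K → ℂ) →ₗ[ℂ] ℂ) ∘ₗ E i) (by
    intro b
    obtain ⟨c, hc⟩ := (hE i).positive b
    change 0 ≤ E i (star b * b) k
    rw [hc]
    exact star_mul_self_nonneg (c k))
  choose G h2 h3 h4 π ξ h5 h6 using h1
  have hEE : ∀ i c, E i (ι i c) = c := fun i => (hE i).apply_incl
  have h7 (i : I) (k : K) (d : K → ℂ) : π i k (ι i d) (ξ i k) = d k • ξ i k := by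
    rw [← sub_eq_zero, ← inner_self_eq_zero (𝕜 := ℂ)]
    have : π i k (ι i d) (ξ i k) - d k • ξ i k = π i k (ι i (d - d k • 1)) (ξ i k) := by
      simp
    rw [this, ← ContinuousLinearMap.adjoint_inner_right, ← ContinuousLinearMap.star_eq_adjoint,
      ← mul_apply_eq_comp, ← map_star, ← map_mul, h5, ← map_star, ← map_mul]
    change E i (ι i (star (d - d k • 1) * (d - d k • 1))) k = 0
    rw [hEE]
    simp
  have h8 (i : I) (k : K) := exists_eigenbasis ((π i k).comp (ι i)) (ξ i k)
    (calc ⟪ξ i k, ξ i k⟫_ℂ = ⟪ξ i k, π i k (ι i 1) (ξ i k)⟫_ℂ := by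
            rw [map_one, map_one, one_apply_eq_self]
      _ = E i (ι i 1) k := h5 i k (ι i 1)
      _ = 1 := by rw [hEE, Pi.one_apply]) k (h7 i k)
  choose L lab bas h9 h10 using h8
  exact ⟨{ G := G, π := π, L := L, lab := lab, bas := bas
           expect := fun i k b => by rw [h9]; exact h5 i k b
           cyclic := fun i k => by rw [h9]; exact h6 i k
           diag_none := fun i k d => by rw [h9]; exact h7 i k d
           diag_some := h10 }⟩

/-- Existence of reduced amalgamated free products over `D = ℂᴷ`. -/
theorem exists_isReducedAmalgamatedFreeProduct {I K : Type} [Nonempty I] [Fintype K]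
    {B : I → Type u} [∀ i, CStarAlgebra (B i)]
    (ι : ∀ i, (K → ℂ) →⋆ₐ[ℂ] B i) (E : ∀ i, B i →ₗ[ℂ] (K → ℂ))
    (hE : ∀ i, IsConditionalExpectation (ι i) (E i)) :
    ∃ (A : Type u) (_ : CStarAlgebra A) (κ : (K → ℂ) →⋆ₐ[ℂ] A) (j : ∀ i, B i →⋆ₐ[ℂ] A)
      (EA : A →ₗ[ℂ] (K → ℂ)), IsReducedAmalgamatedFreeProduct ι E κ j EA := by
  obtain ⟨F⟩ := exists_fockData ι E hE
  exact ⟨opAlg F, inferInstance, _, _, _, opAlg_isReduced F hE⟩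

end AmalgFree

/-! Let `τ` be the sum of the two coordinates of `EA`. As `tr i` is 1 on both minimal projections,
`τ` restricts to `tr i` on each factor; freeness makes it a trace on `A`, and the faithfulness of
the representation on `L²(A, EA)` makes it faithful. It takes the value 1 on the unit of each
corner. Write `‖b‖₂` for `τ(b* b)^(1/2)`.

The argument follows the 2-norm method for reduced free products. By a polar decomposition argument
(`dense_isUnit_of_trace`) it suffices that every `b` in the corner lies within `ρ` of an invertible
element whenever `‖b‖₂ < ρ`. For this, unitaries `L`, `R` of the corner are found such that `x = L b
R` has spectral radius less than `ρ`: then `x - ρ` is invertible, and so is `L* (x - ρ) R*`, which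
is at distance at most `ρ` from `b`.

By density `b` may be taken in the span of `ℂ²` and of alternating centred words. Conjugate by `u₁,
u₂, u₁, …` in turn. At each step an end letter either remains centred after absorbing the unitary,
and then that end never cancels again, or it drops out and the word shortens. What is left
eventually consists of words that no longer cancel and of powers of `u₁ u₂` and their adjoints with
coefficients in `ℂ²` (`FreePair.word_mem_tame`). Conjugation alone only rotates these powers;
replacing one `u₂` by `u₂'`, with `E(u₂* u₂') = 0`, turns the nontrivial ones into honest words
(`FreePair.conj_tameBase`). So one unitary `v` brings `b`, `b* b` and `b b*` simultaneously into
`ℂ²` plus the words with both ends in `S 0`.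

Now `x = u₂'* v* b v u₂ u₁` is spanned by words from `S 1` to `S 0`, while `x* x` and `x x*` lie in
`ℂ²` plus words with both ends in `S 0`, respectively `S 1`. Split `L²(τ)` into the closed span of
the words starting in `S 1` and its complement. Then `x` is triangular, and the noncentral parts of
`x* x` and `x x*` do not contribute to the norms of the diagonal entries, which are therefore at
most `‖b‖₂`. Hence `‖x ^ n‖` grows at most like `n r ^ n` for any `r > ‖b‖₂`
(`FreePair.exists_norm_pow_le`). All unitaries commute with `ℂ²`, so the whole argument compresses
to the corners. -/

namespace AmalgFree

/-! ### A 2-norm criterion for stable rank one -/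

section StableRank

variable {C : Type*} [CStarAlgebra C]

/-- A Neumann series inverts `ρ ^ n - x ^ n`, and `x - ρ` is a factor of this on either side by the
geometric sum. -/
theorem isUnit_sub_of_norm_pow_lt {x : C} {ρ : ℝ} {n : ℕ} (h : ‖x ^ n‖ < ρ ^ n) :
    IsUnit (x - algebraMap ℂ C ρ) := by
  have h1 : IsUnit (algebraMap ℂ C (ρ ^ n) - x ^ n) := by
    have hρ : ((ρ : ℂ) ^ n) ≠ 0 := by
      have : (0 : ℝ) < ρ ^ n := (norm_nonneg _).trans_lt h
      exact_mod_cast this.ne'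
    have h2 : IsUnit (1 - ((ρ : ℂ) ^ n)⁻¹ • x ^ n) := by
      refine isUnit_one_sub_of_norm_lt_one ?_
      have h3 : (0 : ℝ) < ρ ^ n := (norm_nonneg _).trans_lt h
      have h4 : ‖(ρ : ℂ) ^ n‖ = ρ ^ n := by
        rw [← Complex.ofReal_pow, Complex.norm_real, Real.norm_of_nonneg h3.le]
      rw [norm_smul, norm_inv, h4, inv_mul_lt_one₀ h3]
      exact h
    have h5 : algebraMap ℂ C (ρ ^ n) - x ^ n
        = algebraMap ℂ C (ρ ^ n) * (1 - ((ρ : ℂ) ^ n)⁻¹ • x ^ n) := by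
      rw [mul_sub, mul_one, ← Algebra.smul_def, smul_smul, mul_inv_cancel₀ hρ, one_smul]
    rw [h5]
    exact ((IsUnit.mk0 _ hρ).map (algebraMap ℂ C)).mul h2
  have hc : Commute x (algebraMap ℂ C ρ) := (Algebra.commutes _ _).symm
  have h6 := hc.geom_sum₂_mul n
  have h7 := hc.mul_geom_sum₂ n
  have h8 : IsUnit (x ^ n - algebraMap ℂ C ρ ^ n) := by
    rw [← map_pow, ← neg_sub]; exact h1.neg
  obtain ⟨v, hv⟩ := h8
  set c := ∑ i ∈ Finset.range n, x ^ i * algebraMap ℂ C ρ ^ (n - 1 - i)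
  rw [isUnit_iff_exists_and_exists]
  refine ⟨⟨c * ↑v⁻¹, ?_⟩, ⟨↑v⁻¹ * c, ?_⟩⟩
  · rw [← mul_assoc, h7, ← hv, Units.mul_inv]
  · rw [mul_assoc, h6, ← hv, Units.inv_mul]

/-- If the contraction `x` has distance less than one to the invertible elements and the positive
element `k` lives where `x` is isometric, then `x * k` is a limit of invertible elements. -/
theorem exists_isUnit_near_mul {x g k : C} (hx : ‖x‖ ≤ 1) (hg : IsUnit g) (hxg : ‖x - g‖ < 1)
    (hk : star k = k) (hkx : k * (star x * x) = k)
    (hkε : ∀ ε : ℝ, 0 < ε → IsUnit (k + algebraMap ℂ C ε)) {ε : ℝ} (hε : 0 < ε) :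
    ∃ h : C, IsUnit h ∧ ‖x * k - h‖ < ε := by
  obtain ⟨g, rfl⟩ := hg
  -- Since `k x* x = k`, this unit `y` satisfies `k y = k x* g`. So `x k` is the adjoint of `k`
  -- times the invertible `y g⁻¹`, and adding a small scalar to `k` makes the product invertible.
  have hy : IsUnit (1 - star x * (x - g)) := by
    refine isUnit_one_sub_of_norm_lt_one ((norm_mul_le _ _).trans_lt ?_)
    rw [norm_star]
    calc ‖x‖ * ‖x - g‖ ≤ 1 * ‖x - g‖ := by gcongr
      _ < 1 := by rwa [one_mul]
  set y := 1 - star x * (x - g) with hy'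
  have h1 : k * y = k * star x * g := by
    rw [hy', mul_sub, mul_sub, mul_sub, hkx]
    simp [mul_assoc]
  have h2 : k * y * ↑g⁻¹ = k * star x := by
    rw [h1, mul_assoc, Units.mul_inv, mul_one]
  set c := y * (↑g⁻¹ : C) with hc
  have hcu : IsUnit c := hy.mul (Units.isUnit _)
  obtain ⟨η, hη, hηε⟩ : ∃ η : ℝ, 0 < η ∧ η * ‖c‖ < ε := by
    refine ⟨ε / (‖c‖ + 1), by positivity, ?_⟩
    rw [div_mul_eq_mul_div, div_lt_iff₀ (by positivity)]
    nlinarith [norm_nonneg c]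
  refine ⟨star ((k + algebraMap ℂ C η) * c), ((hkε η hη).mul hcu).star, ?_⟩
  have h3 : x * k - star ((k + algebraMap ℂ C η) * c) = - star (algebraMap ℂ C η * c) := by
    have h4 : x * k = star (k * c) := by
      rw [hc, ← mul_assoc, h2, star_mul, star_star, hk]
    rw [h4, ← star_sub, add_mul, ← star_neg]
    congr 1
    abel
  rw [h3, norm_neg, norm_star, ← Algebra.smul_def, norm_smul, Complex.norm_real,
    Real.norm_of_nonneg hη.le]
  exact hηε

/-- A regularised polar part `x` of `a` is a contraction, so its 2-norm is at most 1. Hence either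
the hypothesis places `x` at distance less than 1 from the invertibles, or `x` is unitary; in both
cases `exists_isUnit_near_mul` applies and approximates `a`. -/
theorem dense_isUnit_of_trace (τ : C →ₗ[ℂ] ℂ) (hτ : IsFaithfulTrace τ) (hτ1 : τ 1 = 1)
    (h : ∀ (b : C) (ρ : ℝ), 0 < ρ → (τ (star b * b)).re < ρ ^ 2 →
      ∃ g : C, IsUnit g ∧ ‖b - g‖ ≤ ρ) : Dense {a : C | IsUnit a} := by
  rw [Metric.dense_iff]
  intro a r hr
  obtain ⟨δ, hδ, hδr⟩ : ∃ δ : ℝ, 0 < δ ∧ δ < r / 2 := ⟨r / 4, by linarith, by linarith⟩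
  set s := star a * a with hs
  have hsa : IsSelfAdjoint s := IsSelfAdjoint.star_mul_self a
  have hsp : ∀ t ∈ spectrum ℝ s, 0 ≤ t := spectrum_star_mul_self_nonneg
  -- `m` replaces `1 / √t` and `κ` truncates `√t`, so that `a * m(s)` serves as polar part and
  -- `κ(s)` as modulus. The function `f` belongs to `x* x` and equals 1 wherever `κ` is nonzero.
  let m : ℝ → ℝ := fun t => (max (√t) δ)⁻¹
  have hm : Continuous m := by
    refine Continuous.inv₀ (by fun_prop) fun t => ?_
    exact (lt_max_of_lt_right hδ).ne'
  let κ : ℝ → ℝ := fun t => max (√t - δ) 0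
  have hκ : Continuous κ := by fun_prop
  let f : ℝ → ℝ := fun t => m t * t * m t
  have hf : Continuous f := by fun_prop
  have hf1 : ∀ t, 0 ≤ t → f t ≤ 1 := by
    intro t ht
    have h1 : √t * m t ≤ 1 := by
      rw [← div_eq_mul_inv, div_le_one (lt_max_of_lt_right hδ)]
      exact le_max_left _ _
    have h2 : 0 ≤ √t * m t := mul_nonneg (Real.sqrt_nonneg _)
      (inv_nonneg.2 (hδ.le.trans (le_max_right _ _)))
    have h3 : f t = (√t * m t) ^ 2 := by
      rw [mul_pow, Real.sq_sqrt ht]; ring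
    rw [h3]
    exact pow_le_one₀ h2 h1
  have hf0 : ∀ t, 0 ≤ t → 0 ≤ f t := fun t ht => by
    have h3 : f t = t * (m t) ^ 2 := by ring
    rw [h3]; positivity
  have key : ∀ t, 0 ≤ t → (t ≤ δ ^ 2 ∧ κ t = 0) ∨
      (κ t = √t - δ ∧ m t = (√t)⁻¹ ∧ f t = 1 ∧ δ < √t) := by
    intro t ht
    rcases le_or_gt (√t) δ with h1 | h1
    · left
      refine ⟨?_, max_eq_right (by linarith)⟩
      rw [← Real.sq_sqrt ht]
      exact pow_le_pow_left₀ (Real.sqrt_nonneg _) h1 2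
    · right
      have h2 : m t = (√t)⁻¹ := by simp only [m]; rw [max_eq_left h1.le]
      have h3 : (0 : ℝ) < √t := hδ.trans h1
      refine ⟨max_eq_left (by linarith), h2, ?_, h1⟩
      simp only [f]
      rw [h2]
      nth_rewrite 2 [← Real.sq_sqrt ht]
      field_simp
  have hstar : ∀ u : ℝ → ℝ, star (cfc u s) = cfc u s := fun u => cfc_predicate u s
  have hcomb : ∀ u : ℝ → ℝ, Continuous u →
      star (a * cfc u s) * (a * cfc u s) = cfc (fun t => u t * t * u t) s := by
    intro u hu
    have h1 : cfc (fun t : ℝ => t) s = s := cfc_id' ℝ s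
    rw [cfc_mul (fun t => u t * t) u s (by fun_prop) (by fun_prop),
      cfc_mul u (fun t => t) s (by fun_prop) (by fun_prop), h1, star_mul, hstar, hs]
    simp only [mul_assoc]
  set x := a * cfc m s with hx
  have hxx : star x * x = cfc f s := hcomb m hm
  have hx1 : ‖x‖ ≤ 1 := by
    have h1 : ‖x‖ * ‖x‖ ≤ 1 := by
      rw [← CStarRing.norm_star_mul_self, hxx]
      refine norm_cfc_le zero_le_one fun t ht => ?_
      rw [Real.norm_of_nonneg (hf0 t (hsp t ht))]
      exact hf1 t (hsp t ht)
    nlinarith [norm_nonneg x]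
  obtain ⟨g, hg, hxg⟩ : ∃ g : C, IsUnit g ∧ ‖x - g‖ < 1 := by
    have h1 : 1 - star x * x = star (cfc (fun t => √(1 - f t)) s) * cfc (fun t => √(1 - f t)) s := by
      rw [hstar, ← cfc_mul _ _ s (by fun_prop) (by fun_prop), hxx]
      nth_rewrite 1 [← cfc_one ℝ s]
      rw [← cfc_sub _ _ s (by fun_prop) (by fun_prop)]
      refine cfc_congr fun t ht => ?_
      exact (Real.mul_self_sqrt (sub_nonneg.2 (hf1 t (hsp t ht)))).symm
    have h2 : 0 ≤ τ (1 - star x * x) := h1 ▸ hτ.nonneg _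
    rw [map_sub, hτ1] at h2
    have h3 := (Complex.le_def.1 h2).1
    simp only [Complex.zero_re, Complex.sub_re, Complex.one_re] at h3
    -- If the 2-norm of `x` is 1, then `x` is an isometry because `τ` is faithful, and a unitary
    -- because `τ` is moreover tracial.
    rcases h3.lt_or_eq with h4 | h4
    · obtain ⟨ρ, h5, h6⟩ := exists_between (show √((τ (star x * x)).re) < 1 by
        rw [Real.sqrt_lt' one_pos]; linarith)
      have h7 : 0 < ρ := (Real.sqrt_nonneg _).trans_lt h5
      obtain ⟨g, hg, hgx⟩ := h x ρ h7 ((Real.sqrt_lt' h7).1 h5)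
      exact ⟨g, hg, hgx.trans_lt h6⟩
    · refine ⟨x, ?_, by simp⟩
      have h5 : τ (1 - star x * x) = 0 := by
        rw [map_sub, hτ1]
        refine Complex.ext ?_ ?_
        · simpa using h4.symm
        · exact (Complex.le_def.1 h2).2.symm
      have h6 : star x * x = 1 := by
        have := hτ.faithful _ (h1 ▸ h5)
        rw [this, mul_zero] at h1
        exact (sub_eq_zero.1 h1).symm
      have h7 : star (1 - x * star x) * (1 - x * star x) = 1 - x * star x := by
        have : x * star x * (x * star x) = x * star x := by
          rw [mul_assoc, ← mul_assoc (star x), h6, one_mul]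
        rw [star_sub, star_one, star_mul, star_star, mul_sub, sub_mul, sub_mul, this]
        simp
      have h8 : 1 - x * star x = 0 := by
        refine hτ.faithful _ ?_
        rw [h7, map_sub, hτ.tracial, h6, sub_self]
      exact isUnit_iff_exists.2 ⟨star x, (sub_eq_zero.1 h8).symm, h6⟩
  set k := cfc κ s with hk
  have hkx : k * (star x * x) = k := by
    rw [hxx, hk, ← cfc_mul _ _ s (by fun_prop) (by fun_prop)]
    refine cfc_congr fun t ht => ?_
    rcases key t (hsp t ht) with ⟨-, h1⟩ | ⟨-, -, h1, -⟩
    · simp [h1]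
    · simp [h1]
  have hkε : ∀ ε : ℝ, 0 < ε → IsUnit (k + algebraMap ℂ C ε) := by
    intro ε hε
    have h1 : algebraMap ℂ C ε = algebraMap ℝ C ε := by
      rw [IsScalarTower.algebraMap_apply ℝ ℂ C]; rfl
    rw [h1, ← cfc_const ε s, hk, ← cfc_add s κ (fun _ => ε) (by fun_prop) (by fun_prop),
      isUnit_cfc_iff _ s (by fun_prop)]
    intro t _
    have : 0 ≤ κ t := le_max_right _ _
    positivity
  obtain ⟨y, hy, hxy⟩ := exists_isUnit_near_mul hx1 hg hxg (hstar κ) hkx hkε (half_pos hr)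
  refine ⟨y, ?_, hy⟩
  -- The function `t (1 - m κ)²` is `t ≤ δ²` below the cutoff and exactly `δ²` above it.
  have h1 : ‖a - x * k‖ ≤ δ := by
    have h2 : a - x * k = a * cfc (fun t => 1 - m t * κ t) s := by
      rw [cfc_sub (fun _ => (1 : ℝ)) (fun t => m t * κ t) s (by fun_prop) (by fun_prop),
        cfc_mul m κ s (by fun_prop) (by fun_prop), cfc_const_one ℝ s, mul_sub, mul_one, ← mul_assoc]
    have h3 : ‖a - x * k‖ * ‖a - x * k‖ ≤ δ ^ 2 := by
      rw [← CStarRing.norm_star_mul_self, h2, hcomb _ (by fun_prop)]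
      refine norm_cfc_le (by positivity) fun t ht => ?_
      have ht := hsp t ht
      rw [Real.norm_of_nonneg (by
        have : (1 - m t * κ t) * t * (1 - m t * κ t) = t * (1 - m t * κ t) ^ 2 := by ring
        rw [this]; positivity)]
      rcases key t ht with ⟨h4, h5⟩ | ⟨h4, h5, -, h6⟩
      · rw [h5]; simpa using h4
      · have h7 : (0 : ℝ) < √t := hδ.trans h6
        rw [h4, h5]
        nth_rewrite 3 [← Real.sq_sqrt ht]
        refine le_of_eq ?_
        field_simp
        ring
    nlinarith [norm_nonneg (a - x * k)]
  rw [mem_ball_iff_norm']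
  calc ‖a - y‖ = ‖(a - x * k) + (x * k - y)‖ := by congr 1; abel
    _ ≤ _ := norm_add_le _ _
    _ < r := by linarith

end StableRank

/-! ### Powers of triangular operators -/

section Triangular

variable {H : Type*} [NormedAddCommGroup H] [InnerProductSpace ℂ H]

/-- The projection onto the complement of `W` kills `W` and fixes `W'`, so it maps the dense sum
into `W'`. -/
theorem orthogonal_topologicalClosure_le [CompleteSpace H] {W W' : Submodule ℂ H}
    (horth : ∀ w ∈ W, ∀ w' ∈ W', ⟪w, w'⟫_ℂ = 0)
    (hdense : (W ⊔ W').topologicalClosure = ⊤) :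
    W.topologicalClosureᗮ ≤ W'.topologicalClosure := by
  intro v hv
  let Q := W.topologicalClosureᗮ.starProjection
  have hQ : Q v = v := Submodule.starProjection_eq_self_iff.2 hv
  have h1 : W ⊔ W' ≤ W'.topologicalClosure.comap Q.toLinearMap := by
    refine sup_le (fun w hw => ?_) (fun w hw => ?_)
    · have : Q w = 0 := by
        rw [Submodule.starProjection_apply_eq_zero_iff]
        exact Submodule.le_orthogonal_orthogonal _ (Submodule.le_topologicalClosure _ hw)
      simp [this]
    · have : Q w = w := by
        rw [Submodule.starProjection_eq_self_iff, Submodule.orthogonal_closure]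
        exact (Submodule.mem_orthogonal _ _).2 fun u hu => horth u hu w hw
      simpa [this] using Submodule.le_topologicalClosure _ hw
  have h2 := Submodule.topologicalClosure_minimal _ h1
    ((Submodule.isClosed_topologicalClosure _).preimage Q.continuous)
  rw [hdense] at h2
  have h3 : Q v ∈ W'.topologicalClosure := h2 (Submodule.mem_top (x := v))
  rwa [hQ] at h3

theorem norm_apply_le_of_mem_topologicalClosure {W : Submodule ℂ H} {T : H →L[ℂ] H} {r : ℝ}
    (h : ∀ w ∈ W, ‖T w‖ ≤ r * ‖w‖) : ∀ w ∈ W.topologicalClosure, ‖T w‖ ≤ r * ‖w‖ := by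
  intro w hw
  have hc : IsClosed {w : H | ‖T w‖ ≤ r * ‖w‖} := isClosed_le (by fun_prop) (by fun_prop)
  exact closure_minimal (s := (W : Set H)) h hc hw

/-- Norms of the powers of an operator which is triangular with respect to `W` and its complement,
with diagonal entries of norm at most `r`. -/
theorem norm_pow_le_of_triangular [CompleteSpace H] {W W' : Submodule ℂ H} {T : H →L[ℂ] H} {r : ℝ} (hr : 0 < r)
    (horth : ∀ w ∈ W, ∀ w' ∈ W', ⟪w, w'⟫_ℂ = 0)
    (hdense : (W ⊔ W').topologicalClosure = ⊤)
    (hmap : ∀ w ∈ W, T w ∈ W)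
    (hT : ∀ w ∈ W, ‖T w‖ ≤ r * ‖w‖)
    (hT' : ∀ w ∈ W', ‖star T w‖ ≤ r * ‖w‖) (n : ℕ) :
    ‖T ^ n‖ ≤ (2 + n * (‖T‖ / r)) * r ^ n := by
  let V := W.topologicalClosure
  have hTV := norm_apply_le_of_mem_topologicalClosure hT
  have hTV' : ∀ w ∈ Vᗮ, ‖star T w‖ ≤ r * ‖w‖ := fun w hw =>
    norm_apply_le_of_mem_topologicalClosure hT' w (orthogonal_topologicalClosure_le horth hdense hw)
  have hmapV : ∀ w ∈ V, T w ∈ V := by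
    have : V ≤ V.comap T.toLinearMap :=
      Submodule.topologicalClosure_minimal _
        (fun w hw => Submodule.le_topologicalClosure _ (hmap w hw))
        ((Submodule.isClosed_topologicalClosure _).preimage T.continuous)
    exact this
  have h1 : ∀ n : ℕ, ∀ w ∈ V, ‖(T ^ n) w‖ ≤ r ^ n * ‖w‖ := by
    intro n
    induction n with
    | zero => intro w _; simp
    | succ n ih =>
      intro w hw
      rw [pow_succ]
      calc ‖(T ^ n) (T w)‖ ≤ r ^ n * ‖T w‖ := ih _ (hmapV w hw)
        _ ≤ r ^ n * (r * ‖w‖) := by gcongr; exact hTV w hw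
        _ = r ^ (n + 1) * ‖w‖ := by ring
  have hP : ∀ v, ‖V.starProjection v‖ ≤ ‖v‖ := fun v => V.norm_starProjection_apply_le v
  have hP' : ∀ v, ‖Vᗮ.starProjection v‖ ≤ ‖v‖ := fun v => Vᗮ.norm_starProjection_apply_le v
  have hsum : ∀ v, v = V.starProjection v + Vᗮ.starProjection v := fun v =>
    (V.starProjection_add_starProjection_orthogonal v).symm
  -- The compression of `T` to the complement has the norm of its adjoint, the restriction of `star
  -- T`: with `v` the projection of `T w`, `‖v‖² = ⟪star T v, w⟫`.
  have h2 : ∀ w ∈ Vᗮ, ‖Vᗮ.starProjection (T w)‖ ≤ r * ‖w‖ := by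
    intro w hw
    set v := Vᗮ.starProjection (T w) with hv
    have hvm : v ∈ Vᗮ := Submodule.starProjection_apply_mem _ _
    have h3 : ‖v‖ * ‖v‖ ≤ r * ‖v‖ * ‖w‖ := by
      have h4 : ⟪v, v⟫_ℂ = ⟪star T v, w⟫_ℂ := by
        rw [ContinuousLinearMap.star_eq_adjoint, ContinuousLinearMap.adjoint_inner_left]
        nth_rewrite 2 [hv]
        rw [← Submodule.inner_starProjection_left_eq_right,
          Submodule.starProjection_eq_self_iff.2 hvm]
      have h5 : ‖v‖ * ‖v‖ = ‖⟪v, v⟫_ℂ‖ := by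
        rw [inner_self_eq_norm_sq_to_K]; simp [sq]
      rw [h5, h4]
      calc _ ≤ ‖star T v‖ * ‖w‖ := norm_inner_le_norm _ _
        _ ≤ _ := by gcongr; exact hTV' v hvm
    rcases (norm_nonneg v).eq_or_lt with h0 | h0
    · rw [← h0]; positivity
    · nlinarith
  -- A vector can cross from the complement into `V` only once, since `V` is invariant. The crossing
  -- costs `‖T‖` instead of `r` and may happen at any of the `n` steps, whence the linear factor.
  have h3 : ∀ n : ℕ, ∀ w ∈ Vᗮ, ‖(T ^ n) w‖ ≤ (1 + n * (‖T‖ / r)) * r ^ n * ‖w‖ := by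
    intro n
    induction n with
    | zero => intro w _; simp
    | succ n ih =>
      intro w hw
      rw [pow_succ]
      change ‖(T ^ n) (T w)‖ ≤ _
      rw [hsum (T w), map_add]
      calc _ ≤ ‖(T ^ n) (V.starProjection (T w))‖ + ‖(T ^ n) (Vᗮ.starProjection (T w))‖ :=
            norm_add_le _ _
        _ ≤ r ^ n * ‖V.starProjection (T w)‖
            + (1 + n * (‖T‖ / r)) * r ^ n * ‖Vᗮ.starProjection (T w)‖ := by
            gcongr
            · exact h1 n _ (Submodule.starProjection_apply_mem _ _)
            · exact ih _ (Submodule.starProjection_apply_mem _ _)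
        _ ≤ r ^ n * (‖T‖ * ‖w‖) + (1 + n * (‖T‖ / r)) * r ^ n * (r * ‖w‖) := by
            gcongr
            · exact (hP _).trans (T.le_opNorm w)
            · exact h2 w hw
        _ = _ := by push_cast; field_simp; ring
  refine ContinuousLinearMap.opNorm_le_bound _ (by positivity) fun v => ?_
  rw [hsum v, map_add, ← hsum v]
  calc _ ≤ ‖(T ^ n) (V.starProjection v)‖ + ‖(T ^ n) (Vᗮ.starProjection v)‖ := norm_add_le _ _
    _ ≤ r ^ n * ‖V.starProjection v‖
        + (1 + n * (‖T‖ / r)) * r ^ n * ‖Vᗮ.starProjection v‖ := by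
        gcongr
        · exact h1 n _ (Submodule.starProjection_apply_mem _ _)
        · exact h3 n _ (Submodule.starProjection_apply_mem _ _)
    _ ≤ r ^ n * ‖v‖ + (1 + n * (‖T‖ / r)) * r ^ n * ‖v‖ := by
        gcongr
        · exact hP v
        · exact hP' v
    _ = _ := by ring

end Triangular

/-! ### Corners as C⋆-algebras -/

section Corner

variable {A : Type*} [CStarAlgebra A] {p : A}

theorem corner_mul_left (he : IsIdempotentElem p) (x : he.Corner) : p * x.1 = x.1 :=
  ((Subsemigroup.mem_corner_iff he).1 x.2).1

theorem corner_mul_right (he : IsIdempotentElem p) (x : he.Corner) : x.1 * p = x.1 :=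
  ((Subsemigroup.mem_corner_iff he).1 x.2).2

/-- The corner of a self-adjoint projection is a unital C⋆-algebra. -/
noncomputable abbrev cornerCStarAlgebra (he : IsIdempotentElem p) (hs : IsSelfAdjoint p) :
    CStarAlgebra he.Corner :=
  let val : he.Corner →ₙ+* A :=
    { toFun := Subtype.val, map_mul' := fun _ _ => rfl, map_zero' := rfl, map_add' := fun _ _ => rfl }
  -- Pulling back the norm makes its topology agree with `cornerTopology`, in which density is
  -- stated.
  let _ : NormedRing he.Corner := NormedRing.induced _ _ val Subtype.val_injective
  let _ : StarRing he.Corner :=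
    { star := fun x => ⟨star x.1, (Subsemigroup.mem_corner_iff he).2
        ⟨by have := congrArg star (corner_mul_right he x); rwa [star_mul, hs.star_eq] at this,
         by have := congrArg star (corner_mul_left he x); rwa [star_mul, hs.star_eq] at this⟩⟩
      star_involutive := fun x => Subtype.ext (star_star x.1)
      star_mul := fun x y => Subtype.ext (star_mul x.1 y.1)
      star_add := fun x y => Subtype.ext (star_add x.1 y.1) }
  let _ : Module ℂ he.Corner :=
    { smul := fun c x => ⟨c • x.1, (Subsemigroup.mem_corner_iff he).2
        ⟨by rw [mul_smul_comm, corner_mul_left], by rw [smul_mul_assoc, corner_mul_right]⟩⟩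
      one_smul := fun x => Subtype.ext (one_smul ℂ x.1)
      mul_smul := fun c d x => Subtype.ext (mul_smul c d x.1)
      smul_zero := fun c => Subtype.ext (smul_zero c)
      smul_add := fun c x y => Subtype.ext (smul_add c x.1 y.1)
      add_smul := fun c d x => Subtype.ext (add_smul c d x.1)
      zero_smul := fun x => Subtype.ext (zero_smul ℂ x.1) }
  let _ : Algebra ℂ he.Corner := Algebra.ofModule
    (fun c x y => Subtype.ext (smul_mul_assoc c x.1 y.1))
    (fun c x y => Subtype.ext (mul_smul_comm c x.1 y.1))
  { norm_smul_le := fun c x => norm_smul_le c x.1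
    norm_mul_self_le := fun x => CStarRing.norm_mul_self_le x.1
    star_smul := fun c x => Subtype.ext (star_smul c x.1)
    complete := by
      have h : IsClosed {x : A | p * x = x ∧ x * p = x} :=
        (isClosed_eq (by fun_prop) (by fun_prop)).inter (isClosed_eq (by fun_prop) (by fun_prop))
      have h2 : {x : A | p * x = x ∧ x * p = x} = Set.range (Subtype.val : he.Corner → A) := by
        ext x
        refine ⟨fun hx => ⟨⟨x, (Subsemigroup.mem_corner_iff he).2 hx⟩, rfl⟩, ?_⟩
        rintro ⟨x, rfl⟩
        exact ⟨corner_mul_left he x, corner_mul_right he x⟩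
      have h3 : IsUniformInducing (Subtype.val : he.Corner → A) := ⟨rfl⟩
      rw [h2] at h
      exact fun {f} hf =>
        ((completeSpace_iff_isComplete_range h3).2 h.isComplete).complete hf }

end Corner

theorem fin_two_add_one_add_one (i : Fin 2) : i + 1 + 1 = i := by
  fin_cases i <;> rfl

theorem fin_two_eq_or (i j : Fin 2) : i = j ∨ i = j + 1 := by
  fin_cases i <;> fin_cases j <;> simp

/-! ### Alternating words in a free pair -/

section Words

variable {A : Type*} [CStarAlgebra A]

/-- Alternating products of centred letters: `IsWord EA S i j n a` says that `a` is such a product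
of `n` letters, the first one from `S i` and the last one from `S j`. -/
inductive IsWord (EA : A →ₗ[ℂ] (Fin 2 → ℂ)) (S : Fin 2 → StarSubalgebra ℂ A) :
    Fin 2 → Fin 2 → ℕ → A → Prop
  | letter {i : Fin 2} {a : A} (ha : a ∈ S i) (h0 : EA a = 0) : IsWord EA S i i 1 a
  | cons {i j : Fin 2} {n : ℕ} {a w : A} (ha : a ∈ S i) (h0 : EA a = 0)
      (hw : IsWord EA S (i + 1) j n w) : IsWord EA S i j (n + 1) (a * w)

/-- Two subalgebras of a C⋆-algebra which are free over the diagonal algebra `ℂ²` with respect to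
the conditional expectation `EA`, such that the sum of the coordinates of `EA` is a trace on each
of them. -/
structure FreePair (κ : (Fin 2 → ℂ) →⋆ₐ[ℂ] A) (EA : A →ₗ[ℂ] (Fin 2 → ℂ))
    (S : Fin 2 → StarSubalgebra ℂ A) : Prop where
  incl_mem : ∀ i d, κ d ∈ S i
  apply_incl : ∀ d, EA (κ d) = d
  bimodule : ∀ d b d', EA (κ d * b * κ d') = d * EA b * d'
  star_apply : ∀ a, EA (star a) = star (EA a)
  expect_word : ∀ {i j n a}, IsWord EA S i j n a → EA a = 0
  tracial : ∀ i, ∀ a ∈ S i, ∀ b ∈ S i, ∑ k, EA (a * b) k = ∑ k, EA (b * a) k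

/-- A unitary from the `i`-th subalgebra with zero expectation which commutes with `ℂ²`. -/
structure DiagUnitary (κ : (Fin 2 → ℂ) →⋆ₐ[ℂ] A) (EA : A →ₗ[ℂ] (Fin 2 → ℂ))
    (S : Fin 2 → StarSubalgebra ℂ A) (i : Fin 2) (z : A) : Prop where
  mem : z ∈ S i
  expect : EA z = 0
  star_mul_self : star z * z = 1
  mul_star_self : z * star z = 1
  comm : ∀ d, κ d * z = z * κ d

variable {κ : (Fin 2 → ℂ) →⋆ₐ[ℂ] A} {EA : A →ₗ[ℂ] (Fin 2 → ℂ)} {S : Fin 2 → StarSubalgebra ℂ A}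

theorem IsWord.mul {i j k : Fin 2} {n m : ℕ} {a b : A} (ha : IsWord EA S i j n a)
    (hb : IsWord EA S (j + 1) k m b) : IsWord EA S i k (n + m) (a * b) := by
  induction ha with
  | letter ha h0 => rw [add_comm]; exact .cons ha h0 hb
  | cons ha h0 _ ih => rw [mul_assoc, add_right_comm]; exact .cons ha h0 (ih hb)

theorem IsWord.snoc {i j : Fin 2} {n : ℕ} {w a : A} (hw : IsWord EA S i (j + 1) n w)
    (ha : a ∈ S j) (h0 : EA a = 0) : IsWord EA S i j (n + 1) (w * a) :=
  hw.mul (by rw [fin_two_add_one_add_one]; exact .letter ha h0)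

namespace FreePair

variable (F : FreePair κ EA S)
include F

theorem expect_incl_mul (d : Fin 2 → ℂ) (a : A) : EA (κ d * a) = d * EA a := by
  simpa using F.bimodule d a 1

theorem expect_mul_incl (d : Fin 2 → ℂ) (a : A) : EA (a * κ d) = EA a * d := by
  simpa using F.bimodule 1 a d

theorem word_star {i j : Fin 2} {n : ℕ} {a : A} (ha : IsWord EA S i j n a) :
    IsWord EA S j i n (star a) := by
  induction ha with
  | letter ha h0 => exact .letter (star_mem ha) (by rw [F.star_apply, h0, star_zero])
  | cons ha h0 _ ih =>
    rw [star_mul]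
    exact ih.snoc (star_mem ha) (by rw [F.star_apply, h0, star_zero])

theorem word_incl_mul {i j : Fin 2} {n : ℕ} {a : A} (d : Fin 2 → ℂ) (ha : IsWord EA S i j n a) :
    IsWord EA S i j n (κ d * a) := by
  cases ha with
  | letter ha h0 =>
    exact .letter (mul_mem (F.incl_mem _ d) ha) (by rw [F.expect_incl_mul, h0, mul_zero])
  | cons ha h0 hw =>
    rw [← mul_assoc]
    exact .cons (mul_mem (F.incl_mem _ d) ha) (by rw [F.expect_incl_mul, h0, mul_zero]) hw

theorem word_mul_incl {i j : Fin 2} {n : ℕ} {a : A} (d : Fin 2 → ℂ) (ha : IsWord EA S i j n a) :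
    IsWord EA S i j n (a * κ d) := by
  have := F.word_star (F.word_incl_mul (star d) (F.word_star ha))
  rwa [star_mul, star_star, ← map_star, star_star] at this

/-- Split off the last letter of a word whose end letters come from different algebras. -/
theorem word_eq_mul_letter {i : Fin 2} {n : ℕ} {a : A} (ha : IsWord EA S (i + 1) i n a) :
    ∃ w b m, n = m + 1 ∧ a = w * b ∧ b ∈ S i ∧ EA b = 0 ∧ IsWord EA S (i + 1) (i + 1) m w := by
  have h1 := F.word_star ha
  generalize hc : star a = c at h1
  generalize hj : i + 1 = j at h1
  cases h1 with
  | letter => fin_cases i <;> simp at hj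
  | @cons _ _ m b w hb h0 hw =>
    subst hj
    refine ⟨star w, star b, m, rfl, by rw [← star_star a, hc, star_mul], star_mem hb, ?_,
      F.word_star hw⟩
    rw [F.star_apply, h0, star_zero]

/-- The decomposition of an element into its expectation and a centred element. -/
theorem exists_centred {i : Fin 2} {a : A} (ha : a ∈ S i) :
    ∃ e d, e ∈ S i ∧ EA e = 0 ∧ a = e + κ d :=
  ⟨a - κ (EA a), EA a, sub_mem ha (F.incl_mem _ _), by rw [map_sub, F.apply_incl, sub_self],
    by abel⟩

/-- The `k`-th coordinate of `EA b` is the trace of `κ(e_k) b`, where `e_k` is the `k`-th minimal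
projection. As `z` commutes with `κ(e_k)`, it cancels under the trace on `S i`. -/
theorem expect_conj {i : Fin 2} {z a : A} (hz : DiagUnitary κ EA S i z) (ha : a ∈ S i) :
    EA (star z * a * z) = EA a := by
  have key : ∀ (b : A) (k : Fin 2), ∑ l, EA (κ (Pi.single k 1) * b) l = EA b k := by
    intro b k
    simp [F.expect_incl_mul, Pi.single_apply]
  ext k
  rw [← key, ← key]
  have h1 : κ (Pi.single k 1) * (star z * a * z)
      = star z * (κ (Pi.single k 1) * a * z) := by
    have h2 : κ (Pi.single k 1) * star z = star z * κ (Pi.single k 1) := by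
      have := congrArg star (hz.comm (star (Pi.single k 1)))
      simpa [← map_star] using this.symm
    simp only [← mul_assoc, h2]
  have h3 : κ (Pi.single k 1) * a ∈ S i := mul_mem (F.incl_mem _ _) ha
  rw [h1, F.tracial i _ (star_mem hz.mem) _ (mul_mem h3 hz.mem), mul_assoc _ z,
    hz.mul_star_self, mul_one]

end FreePair

theorem DiagUnitary.star_comm {i : Fin 2} {z : A} (hz : DiagUnitary κ EA S i z) (d : Fin 2 → ℂ) :
    κ d * star z = star z * κ d := by
  have := congrArg star (hz.comm (star d))
  simpa [← map_star] using this.symm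

theorem DiagUnitary.star_isWord (F : FreePair κ EA S) {i : Fin 2} {z : A}
    (hz : DiagUnitary κ EA S i z) : IsWord EA S i i 1 (star z) :=
  F.word_star (.letter hz.mem hz.expect)

/-- The span of the words with first letter in `S i` and last letter in `S j`. -/
noncomputable def wordSpan (EA : A →ₗ[ℂ] (Fin 2 → ℂ)) (S : Fin 2 → StarSubalgebra ℂ A) (i j : Fin 2) :
    Submodule ℂ A :=
  Submodule.span ℂ {a | ∃ n, IsWord EA S i j n a}

theorem IsWord.mem_wordSpan {i j : Fin 2} {n : ℕ} {a : A} (ha : IsWord EA S i j n a) :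
    a ∈ wordSpan EA S i j :=
  Submodule.subset_span ⟨n, ha⟩

theorem wordSpan_mul {i j k : Fin 2} {a b : A} (ha : a ∈ wordSpan EA S i j)
    (hb : b ∈ wordSpan EA S (j + 1) k) : a * b ∈ wordSpan EA S i k := by
  have h : wordSpan EA S i j * wordSpan EA S (j + 1) k ≤ wordSpan EA S i k := by
    rw [wordSpan, wordSpan, Submodule.span_mul_span, Submodule.span_le]
    rintro _ ⟨a, ⟨n, ha⟩, b, ⟨m, hb⟩, rfl⟩
    exact (ha.mul hb).mem_wordSpan
  exact h (Submodule.mul_mem_mul ha hb)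

theorem wordSpan_mul' {i j k l : Fin 2} (hkl : k ≠ l) {a b : A} (ha : a ∈ wordSpan EA S i k)
    (hb : b ∈ wordSpan EA S l j) : a * b ∈ wordSpan EA S i j := by
  obtain rfl := (fin_two_eq_or l k).resolve_left hkl.symm
  exact wordSpan_mul ha hb

namespace FreePair

variable (F : FreePair κ EA S)
include F

theorem wordSpan_star {i j : Fin 2} {a : A} (ha : a ∈ wordSpan EA S i j) :
    star a ∈ wordSpan EA S j i := by
  induction ha using Submodule.span_induction with
  | mem a ha => obtain ⟨n, ha⟩ := ha; exact (F.word_star ha).mem_wordSpan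
  | zero => simp
  | add a b _ _ ha hb => rw [star_add]; exact add_mem ha hb
  | smul c a _ ha => rw [star_smul]; exact Submodule.smul_mem _ _ ha

theorem wordSpan_incl_mul {i j : Fin 2} {a : A} (d : Fin 2 → ℂ) (ha : a ∈ wordSpan EA S i j) :
    κ d * a ∈ wordSpan EA S i j := by
  induction ha using Submodule.span_induction with
  | mem a ha => obtain ⟨n, ha⟩ := ha; exact (F.word_incl_mul d ha).mem_wordSpan
  | zero => simp
  | add a b _ _ ha hb => rw [mul_add]; exact add_mem ha hb
  | smul c a _ ha => rw [mul_smul_comm]; exact Submodule.smul_mem _ _ ha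

theorem wordSpan_mul_incl {i j : Fin 2} {a : A} (d : Fin 2 → ℂ) (ha : a ∈ wordSpan EA S i j) :
    a * κ d ∈ wordSpan EA S i j := by
  have := F.wordSpan_star (F.wordSpan_incl_mul (star d) (F.wordSpan_star ha))
  rwa [star_mul, star_star, ← map_star, star_star] at this

theorem expect_wordSpan {i j : Fin 2} {a : A} (ha : a ∈ wordSpan EA S i j) : EA a = 0 := by
  have h : wordSpan EA S i j ≤ LinearMap.ker EA :=
    Submodule.span_le.2 fun a ⟨_, ha⟩ => F.expect_word ha
  exact h ha

end FreePair

/-- The linear span of `ℂ²` and of all words. -/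
noncomputable def reduced (κ : (Fin 2 → ℂ) →⋆ₐ[ℂ] A) (EA : A →ₗ[ℂ] (Fin 2 → ℂ))
    (S : Fin 2 → StarSubalgebra ℂ A) : Submodule ℂ A :=
  Submodule.span ℂ (Set.range κ ∪ {a | ∃ i j n, IsWord EA S i j n a})

theorem incl_mem_reduced (d : Fin 2 → ℂ) : κ d ∈ reduced κ EA S :=
  Submodule.subset_span (Or.inl ⟨d, rfl⟩)

theorem IsWord.mem_reduced {i j : Fin 2} {n : ℕ} {a : A} (ha : IsWord EA S i j n a) :
    a ∈ reduced κ EA S :=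
  Submodule.subset_span (Or.inr ⟨i, j, n, ha⟩)

namespace FreePair

variable (F : FreePair κ EA S)
include F

theorem incl_mul_mem_reduced (d : Fin 2 → ℂ) {a : A} (ha : a ∈ reduced κ EA S) :
    κ d * a ∈ reduced κ EA S := by
  induction ha using Submodule.span_induction with
  | mem a ha =>
    rcases ha with ⟨d', rfl⟩ | ⟨i, j, n, ha⟩
    · rw [← map_mul]; exact incl_mem_reduced _
    · exact (F.word_incl_mul d ha).mem_reduced
  | zero => simp
  | add a b _ _ ha hb => rw [mul_add]; exact add_mem ha hb
  | smul c a _ ha => rw [mul_smul_comm]; exact Submodule.smul_mem _ _ ha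

/-- When two adjacent letters come from the same algebra, their product is split into a centred
letter and an element of `ℂ²`. The latter is absorbed by the next letter, so a single merge
suffices. -/
theorem letter_mul_mem_reduced {i : Fin 2} {s : A} (hs : s ∈ S i) {a : A}
    (ha : a ∈ reduced κ EA S) : s * a ∈ reduced κ EA S := by
  have key : ∀ t ∈ S i, EA t = 0 → t * a ∈ reduced κ EA S := by
    intro t ht h0
    induction ha using Submodule.span_induction with
    | mem a ha =>
      rcases ha with ⟨d, rfl⟩ | ⟨j, k, n, ha⟩
      · exact (F.word_mul_incl d (.letter ht h0)).mem_reduced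
      · rcases fin_two_eq_or j i with rfl | rfl
        · cases ha with
          | letter ha _ =>
            obtain ⟨e, d, he, h1, h2⟩ := F.exists_centred (mul_mem ht ha)
            rw [h2]
            exact add_mem (IsWord.letter he h1).mem_reduced (incl_mem_reduced d)
          | cons ha _ hw =>
            obtain ⟨e, d, he, h1, h2⟩ := F.exists_centred (mul_mem ht ha)
            rw [← mul_assoc, h2, add_mul]
            exact add_mem (IsWord.cons he h1 hw).mem_reduced (F.word_incl_mul d hw).mem_reduced
        · exact (IsWord.cons ht h0 ha).mem_reduced
    | zero => simp
    | add a b _ _ ha hb => rw [mul_add]; exact add_mem ha hb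
    | smul c a _ ha => rw [mul_smul_comm]; exact Submodule.smul_mem _ _ ha
  obtain ⟨e, d, he, h1, rfl⟩ := F.exists_centred hs
  rw [add_mul]
  exact add_mem (key e he h1) (F.incl_mul_mem_reduced d ha)

/-- The star subalgebra generated by the two subalgebras is spanned by `ℂ²` and the words. -/
theorem adjoin_le_reduced {a : A}
    (ha : a ∈ StarAlgebra.adjoin ℂ (Set.range κ ∪ ⋃ i, (S i : Set A))) : a ∈ reduced κ EA S := by
  -- Treating `a` and `star a` together makes the adjoint case of the induction a swap.
  have h : ∀ b ∈ reduced κ EA S, a * b ∈ reduced κ EA S ∧ star a * b ∈ reduced κ EA S := by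
    induction ha using StarAlgebra.adjoin_induction with
    | mem x hx =>
      intro b hb
      rcases hx with ⟨d, rfl⟩ | hx
      · rw [← map_star]
        exact ⟨F.incl_mul_mem_reduced _ hb, F.incl_mul_mem_reduced _ hb⟩
      · obtain ⟨i, hx⟩ := Set.mem_iUnion.1 hx
        exact ⟨F.letter_mul_mem_reduced hx hb, F.letter_mul_mem_reduced (star_mem hx) hb⟩
    | algebraMap r =>
      intro b hb
      rw [← algebraMap_star_comm, ← Algebra.smul_def, ← Algebra.smul_def]
      exact ⟨Submodule.smul_mem _ _ hb, Submodule.smul_mem _ _ hb⟩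
    | add x y _ _ hx hy =>
      intro b hb
      rw [star_add, add_mul, add_mul]
      exact ⟨add_mem (hx b hb).1 (hy b hb).1, add_mem (hx b hb).2 (hy b hb).2⟩
    | mul x y _ _ hx hy =>
      intro b hb
      rw [star_mul, mul_assoc, mul_assoc]
      exact ⟨(hx _ (hy b hb).1).1, (hy _ (hx b hb).2).2⟩
    | star x _ hx =>
      intro b hb
      rw [star_star]
      exact (hx b hb).symm
  have h1 := (h 1 (by rw [← map_one κ]; exact incl_mem_reduced _)).1
  rwa [mul_one] at h1

end FreePair

end Words

/-! ### Conjugating words until they stop cancelling -/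

section Tame

variable {A : Type*} [CStarAlgebra A]
variable {κ : (Fin 2 → ℂ) →⋆ₐ[ℂ] A} {EA : A →ₗ[ℂ] (Fin 2 → ℂ)} {S : Fin 2 → StarSubalgebra ℂ A}

/-- The map `c ↦ z* c z`. -/
noncomputable def conjBy (z : A) : A →ₗ[ℂ] A :=
  LinearMap.mulLeft ℂ (star z) ∘ₗ LinearMap.mulRight ℂ z

theorem conjBy_apply (z c : A) : conjBy z c = star z * c * z := by
  simp [conjBy, mul_assoc]

/-- The span of the powers of `z i * z (i + 1)` and their adjoints, over `ℂ²`. -/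
noncomputable def powerSpan (κ : (Fin 2 → ℂ) →⋆ₐ[ℂ] A) (z : Fin 2 → A) (i : Fin 2) :
    Submodule ℂ A :=
  Submodule.span ℂ
    {a | ∃ d k, a = κ d * (z i * z (i + 1)) ^ k ∨ a = star (κ d * (z i * z (i + 1)) ^ k)}

/-- The elements which are tame before any further conjugation, if the next conjugation is
the one by `z i`. -/
noncomputable def tameBase (κ : (Fin 2 → ℂ) →⋆ₐ[ℂ] A) (EA : A →ₗ[ℂ] (Fin 2 → ℂ))
    (S : Fin 2 → StarSubalgebra ℂ A) (z : Fin 2 → A) (i : Fin 2) : Submodule ℂ A :=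
  wordSpan EA S (i + 1) (i + 1) ⊔ powerSpan κ z i

/-- The elements which become tame after conjugation by `n` of the unitaries
`z i, z (i + 1), z i, …` in turn. -/
noncomputable def tameAfter (κ : (Fin 2 → ℂ) →⋆ₐ[ℂ] A) (EA : A →ₗ[ℂ] (Fin 2 → ℂ))
    (S : Fin 2 → StarSubalgebra ℂ A) (z : Fin 2 → A) : ℕ → Fin 2 → Submodule ℂ A
  | 0, i => tameBase κ EA S z i
  | n + 1, i => (tameAfter κ EA S z n (i + 1)).comap (conjBy (z i))

/-- The elements which become tame eventually. -/
noncomputable def tame (κ : (Fin 2 → ℂ) →⋆ₐ[ℂ] A) (EA : A →ₗ[ℂ] (Fin 2 → ℂ))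
    (S : Fin 2 → StarSubalgebra ℂ A) (z : Fin 2 → A) (i : Fin 2) : Submodule ℂ A :=
  ⨆ n, tameAfter κ EA S z n i

/-- Alternating products of the `z i`, `Run z j i y` meaning that the first factor is `z (j + 1)`
and that the next one would be `z i`. -/
inductive Run (z : Fin 2 → A) (j : Fin 2) : Fin 2 → A → Prop
  | nil : Run z j (j + 1) 1
  | snoc {i : Fin 2} {y : A} (hy : Run z j i y) : Run z j (i + 1) (y * z i)

/-- The next factor determines the parity of the length. Only runs of even length are needed later;
the odd ones carry the induction. -/
theorem Run.eq_pow {z : Fin 2 → A} {i j : Fin 2} {y : A} (hy : Run z j i y) :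
    (i = j + 1 → ∃ k : ℕ, y = (z (j + 1) * z j) ^ k) ∧
      (i = j → ∃ k : ℕ, y = (z (j + 1) * z j) ^ k * z (j + 1)) := by
  induction hy with
  | nil => exact ⟨fun _ => ⟨0, by simp⟩, fun h => by fin_cases j <;> simp at h⟩
  | @snoc i y _ ih =>
    refine ⟨fun h => ?_, fun h => ?_⟩
    · obtain rfl : i = j := by simpa using h
      obtain ⟨k, rfl⟩ := ih.2 rfl
      exact ⟨k + 1, by rw [pow_succ, mul_assoc]⟩
    · obtain rfl : i = j + 1 := by rw [← h, fin_two_add_one_add_one]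
      obtain ⟨k, rfl⟩ := ih.1 rfl
      exact ⟨k, rfl⟩

theorem Run.exists_isWord {z : Fin 2 → A} (hz : ∀ i, DiagUnitary κ EA S i (z i)) {i j : Fin 2}
    {y : A} (hy : Run z j i y) : ∃ n, IsWord EA S (j + 1) i n (y * z i) := by
  induction hy with
  | nil => exact ⟨1, by rw [one_mul]; exact .letter (hz _).mem (hz _).expect⟩
  | snoc _ ih =>
    obtain ⟨n, hn⟩ := ih
    exact ⟨n + 1, hn.mul (.letter (hz _).mem (hz _).expect)⟩

namespace FreePair

variable (F : FreePair κ EA S)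
include F

omit F in
-- Conjugation by the first factor rotates the power cyclically: `(z i z (i+1)) ^ k` becomes `(z
-- (i+1) z i) ^ k`.
theorem conjBy_powerSpan {z : Fin 2 → A} (hz : ∀ i, DiagUnitary κ EA S i (z i)) (i : Fin 2) :
    powerSpan κ z i ≤ (powerSpan κ z (i + 1)).comap (conjBy (z i)) := by
  have key : ∀ d k, star (z i) * (κ d * (z i * z (i + 1)) ^ k) * z i
      = κ d * (z (i + 1) * z (i + 1 + 1)) ^ k := by
    intro d k
    have h1 : ∀ k : ℕ, (z i * z (i + 1)) ^ k * z i = z i * (z (i + 1) * z i) ^ k := by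
      intro k
      induction k with
      | zero => simp
      | succ k ih => rw [pow_succ', pow_succ', mul_assoc, ih]; simp only [mul_assoc]
    rw [fin_two_add_one_add_one, ← mul_assoc, ← (hz i).star_comm, mul_assoc, mul_assoc, h1,
      ← mul_assoc (star _), (hz i).star_mul_self, one_mul]
  rw [powerSpan, Submodule.span_le]
  rintro _ ⟨d, k, rfl | rfl⟩
  · refine Submodule.subset_span ⟨d, k, Or.inl ?_⟩
    rw [conjBy_apply, key]
  · refine Submodule.subset_span ⟨d, k, Or.inr ?_⟩
    rw [conjBy_apply, ← key]
    simp [mul_assoc]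

theorem conjBy_wordSpan {z : A} {i : Fin 2} (hz : DiagUnitary κ EA S i z) {c : A}
    (hc : c ∈ wordSpan EA S (i + 1) (i + 1)) : star z * c * z ∈ wordSpan EA S i i := by
  refine wordSpan_mul' ?_ (wordSpan_mul (hz.star_isWord F).mem_wordSpan hc)
    (IsWord.letter hz.mem hz.expect).mem_wordSpan
  fin_cases i <;> simp

/-- Tameness persists: a word with both ends in `S (i+1)` is lengthened by `z i` at both ends
without cancellation, and powers rotate. Hence the stages increase and finitely many elements share
a common one. -/
theorem conjBy_tameBase {z : Fin 2 → A} (hz : ∀ i, DiagUnitary κ EA S i (z i)) (i : Fin 2) :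
    tameBase κ EA S z i ≤ (tameBase κ EA S z (i + 1)).comap (conjBy (z i)) := by
  refine sup_le (fun c hc => ?_) ((conjBy_powerSpan hz i).trans
    (Submodule.comap_mono le_sup_right))
  refine Submodule.mem_sup_left ?_
  rw [fin_two_add_one_add_one, conjBy_apply]
  exact F.conjBy_wordSpan (hz i) hc

theorem tameAfter_mono {z : Fin 2 → A} (hz : ∀ i, DiagUnitary κ EA S i (z i)) (i : Fin 2) :
    Monotone fun n => tameAfter κ EA S z n i := by
  have h : ∀ n i, tameAfter κ EA S z n i ≤ tameAfter κ EA S z (n + 1) i := by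
    intro n
    induction n with
    | zero => exact F.conjBy_tameBase hz
    | succ n ih => exact fun i => Submodule.comap_mono (ih (i + 1))
  exact monotone_nat_of_le_succ fun n => h n i

theorem mem_tame_iff {z : Fin 2 → A} (hz : ∀ i, DiagUnitary κ EA S i (z i)) {i : Fin 2} {c : A} :
    c ∈ tame κ EA S z i ↔ ∃ n, c ∈ tameAfter κ EA S z n i :=
  Submodule.mem_iSup_of_directed _ (F.tameAfter_mono hz i).directed_le

theorem mem_tame_of_conj {z : Fin 2 → A} (hz : ∀ i, DiagUnitary κ EA S i (z i)) {i : Fin 2} {c : A}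
    (hc : star (z i) * c * z i ∈ tame κ EA S z (i + 1)) : c ∈ tame κ EA S z i := by
  obtain ⟨n, hn⟩ := (F.mem_tame_iff hz).1 hc
  rw [← conjBy_apply] at hn
  exact (F.mem_tame_iff hz).2 ⟨n + 1, hn⟩

theorem star_mem_tame {z : Fin 2 → A} (hz : ∀ i, DiagUnitary κ EA S i (z i)) {i : Fin 2} {c : A}
    (hc : c ∈ tame κ EA S z i) : star c ∈ tame κ EA S z i := by
  have h : ∀ n i c, c ∈ tameAfter κ EA S z n i → star c ∈ tameAfter κ EA S z n i := by
    intro n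
    induction n with
    | zero =>
      intro i c hc
      obtain ⟨a, ha, b, hb, rfl⟩ := Submodule.mem_sup.1 hc
      rw [star_add]
      refine Submodule.add_mem_sup (F.wordSpan_star ha) ?_
      clear hc
      induction hb using Submodule.span_induction with
      | mem b hb =>
        obtain ⟨d, k, rfl | rfl⟩ := hb
        · exact Submodule.subset_span ⟨d, k, Or.inr rfl⟩
        · exact Submodule.subset_span ⟨d, k, Or.inl (star_star _)⟩
      | zero => simp
      | add a b _ _ ha hb => rw [star_add]; exact add_mem ha hb
      | smul c a _ ha => rw [star_smul]; exact Submodule.smul_mem _ _ ha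
    | succ n ih =>
      intro i c hc
      change conjBy (z i) (star c) ∈ tameAfter κ EA S z n (i + 1)
      have := ih (i + 1) _ hc
      have h1 : conjBy (z i) (star c) = star (conjBy (z i) c) := by
        simp [conjBy_apply, mul_assoc]
      rw [h1]
      exact this
  rw [F.mem_tame_iff hz] at hc ⊢
  exact hc.imp fun n => h n i c

omit F in
theorem tameBase_le_tame {z : Fin 2 → A} (i : Fin 2) : tameBase κ EA S z i ≤ tame κ EA S z i :=
  le_iSup (fun n => tameAfter κ EA S z n i) 0

omit F in
theorem mem_tame_of_word {z : Fin 2 → A} {i : Fin 2} {n : ℕ} {w : A}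
    (hw : IsWord EA S (i + 1) (i + 1) n w) : w ∈ tame κ EA S z i :=
  tameBase_le_tame i (Submodule.mem_sup_left hw.mem_wordSpan)

omit F in
theorem incl_mul_run_mem_tame {z : Fin 2 → A} {j : Fin 2} {y : A} (d : Fin 2 → ℂ)
    (hy : Run z j (j + 1) y) : κ d * y ∈ tame κ EA S z (j + 1) := by
  obtain ⟨k, rfl⟩ := hy.eq_pow.1 rfl
  refine tameBase_le_tame _ (Submodule.mem_sup_right (Submodule.subset_span ⟨d, k, Or.inl ?_⟩))
  rw [fin_two_add_one_add_one]

/-- A word starting with a letter from `S i`, followed by a run, is tame: successive conjugations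
either stop cancelling or rotate the word until only a run is left. -/
theorem incl_mul_word_mul_run_mem_tame {z : Fin 2 → A} (hz : ∀ i, DiagUnitary κ EA S i (z i))
    {i j : Fin 2} {n : ℕ} {w y : A} (d : Fin 2 → ℂ) (hw : IsWord EA S i j n w) (hy : Run z j i y) :
    κ d * w * y ∈ tame κ EA S z i := by
  induction hw generalizing y d with
  | @letter i a ha h0 =>
    refine F.mem_tame_of_conj hz ?_
    obtain ⟨e, d', he, h1, h2⟩ := F.exists_centred
      (mul_mem (star_mem (hz i).mem) (mul_mem (F.incl_mem i d) ha))
    rw [← mul_assoc, h2, add_mul, add_mul, mul_assoc, mul_assoc]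
    -- The component in `ℂ²` leaves only the run, now of even length and hence a power. The centred
    -- component gives a word with both ends in `S i`, which is already tame for the index `i + 1`.
    refine add_mem ?_ (incl_mul_run_mem_tame d' hy.snoc)
    obtain ⟨n, hn⟩ := hy.exists_isWord hz
    refine mem_tame_of_word (n := n + 1) ?_
    rw [fin_two_add_one_add_one]
    exact .cons he h1 hn
  | @cons i j n a w ha h0 hw ih =>
    refine F.mem_tame_of_conj hz ?_
    obtain ⟨e, d', he, h1, h2⟩ := F.exists_centred
      (mul_mem (star_mem (hz i).mem) (mul_mem (F.incl_mem i d) ha))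
    have h3 : star (z i) * (κ d * (a * w) * y) * z i
        = e * w * (y * z i) + κ d' * w * (y * z i) := by
      rw [← add_mul, ← add_mul, ← h2]
      simp only [mul_assoc]
    rw [h3]
    -- In the `d'` term the word has lost a letter at the front and the run has gained one at the
    -- back.
    refine add_mem ?_ (ih d' hy.snoc)
    obtain ⟨m, hm⟩ := hy.exists_isWord hz
    refine mem_tame_of_word (n := n + 1 + m) ?_
    rw [fin_two_add_one_add_one]
    exact (IsWord.cons he h1 hw).mul hm

/-- If neither end lies in `S k`, the word is tame at once. If only the first does, it is rotated
along an empty run; if only the last does, the adjoint is. If both do, one conjugation leaves a tame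
word and shorter ones. -/
theorem word_mem_tame {z : Fin 2 → A} (hz : ∀ i, DiagUnitary κ EA S i (z i))
    (n : ℕ) : ∀ (i j k : Fin 2) (w : A), IsWord EA S i j n w → w ∈ tame κ EA S z k := by
  induction n using Nat.strong_induction_on with
  | _ n ih =>
  have hrot : ∀ (k : Fin 2) (w : A), IsWord EA S k (k + 1) n w → w ∈ tame κ EA S z k := by
    intro k w hw
    have h1 : Run z (k + 1) k 1 := by
      have := Run.nil (z := z) (j := k + 1)
      rwa [fin_two_add_one_add_one] at this
    simpa using F.incl_mul_word_mul_run_mem_tame hz 1 hw h1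
  intro i j k w hw
  rcases fin_two_eq_or i k with hi | hi <;> rcases fin_two_eq_or j k with hj | hj <;>
    rw [hi, hj] at hw
  · cases hw with
    | letter ha h0 =>
      -- A single letter remains a single centred letter: here the trace on `S k` enters, through
      -- `expect_conj`.
      refine F.mem_tame_of_conj hz (mem_tame_of_word (n := 1) ?_)
      rw [fin_two_add_one_add_one]
      refine .letter (mul_mem (mul_mem (star_mem (hz _).mem) ha) (hz _).mem) ?_
      rw [F.expect_conj (hz _) ha, h0]
    | cons ha h0 hw =>
      obtain ⟨v, b, m, rfl, rfl, hb, hb0, hv⟩ := F.word_eq_mul_letter hw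
      refine F.mem_tame_of_conj hz ?_
      obtain ⟨e, d, he, h1, h2⟩ := F.exists_centred (mul_mem (star_mem (hz _).mem) ha)
      obtain ⟨e', d', he', h1', h2'⟩ := F.exists_centred (mul_mem hb (hz _).mem)
      rename_i a
      have h3 : star (z k) * (a * (v * b)) * z k
          = e * v * e' + e * v * κ d' + κ d * v * e' + κ d * v * κ d' := by
        calc _ = (star (z k) * a) * v * (b * z k) := by simp only [mul_assoc]
          _ = _ := by rw [h2, h2']; simp only [add_mul, mul_add]; abel
      rw [h3]
      -- The doubly centred term is tame. Each other term has lost at least one end letter, and its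
      -- ends may now be of any type, so the induction runs over all types.
      refine add_mem (add_mem (add_mem ?_ ?_) ?_) ?_
      · refine mem_tame_of_word (n := m + 1 + 1) ?_
        rw [fin_two_add_one_add_one]
        exact (IsWord.cons he h1 hv).snoc he' h1'
      · exact ih (m + 1) (by omega) _ _ _ _ (F.word_mul_incl d' (IsWord.cons he h1 hv))
      · exact ih (m + 1) (by omega) _ _ _ _ ((F.word_incl_mul d hv).snoc he' h1')
      · exact ih m (by omega) _ _ _ _ (F.word_mul_incl d' (F.word_incl_mul d hv))
  · exact hrot _ _ hw
  · rw [← star_star w]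
    refine F.star_mem_tame hz (hrot _ _ (F.word_star hw))
  · exact mem_tame_of_word hw

end FreePair

end Tame

/-! ### One unitary that conjugates finitely many elements into good position -/

section DiagWord

variable {A : Type*} [CStarAlgebra A]
variable {κ : (Fin 2 → ℂ) →⋆ₐ[ℂ] A} {EA : A →ₗ[ℂ] (Fin 2 → ℂ)} {S : Fin 2 → StarSubalgebra ℂ A}

/-- A unitary which commutes with `ℂ²`. -/
structure CommUnitary (κ : (Fin 2 → ℂ) →⋆ₐ[ℂ] A) (v : A) : Prop where
  star_mul_self : star v * v = 1
  mul_star_self : v * star v = 1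
  comm : ∀ d, κ d * v = v * κ d

namespace CommUnitary

theorem one : CommUnitary κ (1 : A) := ⟨by simp, by simp, by simp⟩

theorem star {v : A} (hv : CommUnitary κ v) : CommUnitary κ (star v) :=
  ⟨by simp [hv.mul_star_self], by simp [hv.star_mul_self], fun d => by
    have := congrArg Star.star (hv.comm (Star.star d))
    simpa [← map_star] using this.symm⟩

theorem mul {v w : A} (hv : CommUnitary κ v) (hw : CommUnitary κ w) : CommUnitary κ (v * w) where
  star_mul_self := by
    rw [star_mul, mul_assoc, ← mul_assoc (Star.star v), hv.star_mul_self, one_mul,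
      hw.star_mul_self]
  mul_star_self := by
    rw [star_mul, mul_assoc, ← mul_assoc w, hw.mul_star_self, one_mul, hv.mul_star_self]
  comm d := by rw [← mul_assoc, hv.comm, mul_assoc, hw.comm, mul_assoc]

/-- Conjugation by a unitary which commutes with `ℂ²` fixes `ℂ²`. -/
theorem conj_incl {v : A} (hv : CommUnitary κ v) (d : Fin 2 → ℂ) :
    Star.star v * κ d * v = κ d := by
  rw [mul_assoc, hv.comm, ← mul_assoc, hv.star_mul_self, one_mul]

end CommUnitary

theorem DiagUnitary.commUnitary {i : Fin 2} {z : A} (hz : DiagUnitary κ EA S i z) :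
    CommUnitary κ z :=
  ⟨hz.star_mul_self, hz.mul_star_self, hz.comm⟩

/-- The sum of `ℂ²` and of the span of the words with both end letters in `S i`. -/
noncomputable def diagWord (κ : (Fin 2 → ℂ) →⋆ₐ[ℂ] A) (EA : A →ₗ[ℂ] (Fin 2 → ℂ))
    (S : Fin 2 → StarSubalgebra ℂ A) (i : Fin 2) : Submodule ℂ A :=
  (wordSpan EA S i i).comap (LinearMap.id - κ.toAlgHom.toLinearMap ∘ₗ EA)

theorem mem_diagWord {i : Fin 2} {c : A} :
    c ∈ diagWord κ EA S i ↔ c - κ (EA c) ∈ wordSpan EA S i i := Iff.rfl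

namespace FreePair

variable (F : FreePair κ EA S)
include F

theorem incl_mem_diagWord (i : Fin 2) (d : Fin 2 → ℂ) : κ d ∈ diagWord κ EA S i := by
  rw [mem_diagWord, F.apply_incl, sub_self]
  exact zero_mem _

theorem wordSpan_le_diagWord (i : Fin 2) : wordSpan EA S i i ≤ diagWord κ EA S i := by
  intro c hc
  rw [mem_diagWord, F.expect_wordSpan hc, map_zero, sub_zero]
  exact hc

theorem star_mem_diagWord {i : Fin 2} {c : A} (hc : c ∈ diagWord κ EA S i) :
    star c ∈ diagWord κ EA S i := by
  rw [mem_diagWord, F.star_apply, map_star, ← star_sub]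
  exact F.wordSpan_star hc

theorem conj_mem_diagWord {i : Fin 2} {z c : A} (hz : DiagUnitary κ EA S i z)
    (hc : c ∈ diagWord κ EA S (i + 1)) : star z * c * z ∈ diagWord κ EA S i := by
  have h1 : star z * c * z = star z * (c - κ (EA c)) * z + κ (EA c) := by
    rw [mul_sub, sub_mul, hz.commUnitary.conj_incl]; abel
  rw [h1]
  exact add_mem (F.wordSpan_le_diagWord i (F.conjBy_wordSpan hz hc)) (F.incl_mem_diagWord i _)

theorem reduced_le_tame {z : Fin 2 → A} (hz : ∀ i, DiagUnitary κ EA S i (z i)) (i : Fin 2) :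
    reduced κ EA S ≤ tame κ EA S z i := by
  refine Submodule.span_le.2 ?_
  rintro _ (⟨d, rfl⟩ | ⟨j, k, n, hw⟩)
  · exact tameBase_le_tame _ (Submodule.mem_sup_right
      (Submodule.subset_span ⟨d, 0, Or.inl (by simp)⟩))
  · exact F.word_mem_tame hz n _ _ _ _ hw

/-- The unitary depends on the stage `n` and not on the element `c`. If the sequence stops at index
1, one further conjugation by `z 1` brings it to index 0. -/
theorem exists_conj_mem_tameBase {z : Fin 2 → A} (hz : ∀ i, DiagUnitary κ EA S i (z i)) (n : ℕ) :
    ∀ i, ∃ v, CommUnitary κ v ∧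
      ∀ c ∈ tameAfter κ EA S z n i, star v * c * v ∈ tameBase κ EA S z 0 := by
  induction n with
  | zero =>
    refine Fin.forall_fin_two.2 ⟨⟨1, .one, fun c hc => ?_⟩, ⟨z 1, (hz 1).commUnitary, fun c hc => ?_⟩⟩
    · rwa [star_one, one_mul, mul_one]
    · rw [← conjBy_apply]
      exact F.conjBy_tameBase hz 1 hc
  | succ n ih =>
    intro i
    obtain ⟨v, hv, h⟩ := ih (i + 1)
    refine ⟨z i * v, (hz i).commUnitary.mul hv, fun c hc => ?_⟩
    have := h _ hc
    rw [conjBy_apply] at this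
    simpa [mul_assoc] using this

/-- This is where the second unitary of `S 1` breaks the rotation: `(z 0 z 1) ^ (k+1)` becomes `(z'*
z 1) (z 0 z 1) ^ k z 0 z'`, and `z'* z 1` is centred, so this is a word with both ends in `S 1`. -/
theorem conj_tameBase {z : Fin 2 → A} (hz : ∀ i, DiagUnitary κ EA S i (z i)) {z' : A}
    (hz' : DiagUnitary κ EA S 1 z') (h0 : EA (star (z 1) * z') = 0) {c : A}
    (hc : c ∈ tameBase κ EA S z 0) : star (z 0 * z') * c * (z 0 * z') ∈ diagWord κ EA S 1 := by
  have hv := (hz 0).commUnitary.mul hz'.commUnitary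
  have hrun : ∀ k : ℕ, ∃ n, IsWord EA S 0 0 n ((z 0 * z 1) ^ k * z 0) := by
    intro k
    induction k with
    | zero => exact ⟨1, by simpa using IsWord.letter (hz 0).mem (hz 0).expect⟩
    | succ k ih =>
      obtain ⟨n, hn⟩ := ih
      refine ⟨n + 1 + 1, ?_⟩
      rw [pow_succ', mul_assoc, mul_assoc]
      exact .cons (hz 0).mem (hz 0).expect (.cons (hz 1).mem (hz 1).expect hn)
  have hpow : ∀ d k, star (z 0 * z') * (κ d * (z 0 * z 1) ^ k) * (z 0 * z')
      ∈ diagWord κ EA S 1 := by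
    intro d k
    cases k with
    | zero =>
      rw [pow_zero, mul_one, hv.conj_incl]
      exact F.incl_mem_diagWord 1 d
    | succ k =>
      obtain ⟨n, hn⟩ := hrun k
      have h1 : star (z 0 * z') * (κ d * (z 0 * z 1) ^ (k + 1)) * (z 0 * z')
          = κ d * ((star z' * z 1) * ((z 0 * z 1) ^ k * z 0 * z')) := by
        calc _ = (star (z 0 * z') * κ d) * (z 0 * z 1) ^ (k + 1) * (z 0 * z') := by
              simp only [mul_assoc]
          _ = κ d * (star z' * (star (z 0) * z 0) * (z 1 * ((z 0 * z 1) ^ k * z 0 * z'))) := by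
              rw [← hv.star.comm, pow_succ', star_mul]; simp only [mul_assoc]
          _ = _ := by rw [(hz 0).star_mul_self, mul_one]; simp only [mul_assoc]
      rw [h1]
      refine F.wordSpan_le_diagWord 1 (F.wordSpan_incl_mul d (IsWord.mem_wordSpan (n := n + 1 + 1)
        (.cons (mul_mem (star_mem hz'.mem) (hz 1).mem) ?_ (hn.snoc hz'.mem hz'.expect))))
      rw [← star_star (star z' * z 1), F.star_apply, star_mul, star_star, h0, star_zero]
  obtain ⟨a, ha, b, hb, rfl⟩ := Submodule.mem_sup.1 hc
  rw [← conjBy_apply, map_add]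
  refine add_mem ?_ ?_
  · have h1 := F.conjBy_wordSpan (i := 1) hz' (F.conjBy_wordSpan (hz 0) ha)
    rw [conjBy_apply]
    exact F.wordSpan_le_diagWord 1 (by simpa [mul_assoc] using h1)
  · have h2 : powerSpan κ z 0 ≤ (diagWord κ EA S 1).comap (conjBy (z 0 * z')) := by
      refine Submodule.span_le.2 ?_
      rintro _ ⟨d, k, rfl | rfl⟩
      · change conjBy _ _ ∈ diagWord κ EA S 1
        rw [conjBy_apply]
        exact hpow d k
      · change conjBy _ _ ∈ diagWord κ EA S 1
        rw [conjBy_apply]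
        have := F.star_mem_diagWord (hpow d k)
        rw [zero_add]
        simpa only [star_mul, star_star, mul_assoc] using this
    exact h2 hb

/-- Finite sets of reduced elements are conjugated into `diagWord κ EA S 0` by a common unitary. -/
theorem exists_conj_mem_diagWord {z₁ z₂ z₂' : A} (hz₁ : DiagUnitary κ EA S 0 z₁)
    (hz₂ : DiagUnitary κ EA S 1 z₂) (hz₂' : DiagUnitary κ EA S 1 z₂')
    (h0 : EA (star z₂ * z₂') = 0) {a b c : A} (ha : a ∈ reduced κ EA S)
    (hb : b ∈ reduced κ EA S) (hc : c ∈ reduced κ EA S) :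
    ∃ v, CommUnitary κ v ∧ star v * a * v ∈ diagWord κ EA S 0 ∧
      star v * b * v ∈ diagWord κ EA S 0 ∧ star v * c * v ∈ diagWord κ EA S 0 := by
  have hz : ∀ i, DiagUnitary κ EA S i (![z₁, z₂] i) := Fin.forall_fin_two.2 ⟨hz₁, hz₂⟩
  have key : ∀ {c}, c ∈ reduced κ EA S → ∃ n, c ∈ tameAfter κ EA S ![z₁, z₂] n 0 := fun hc =>
    (F.mem_tame_iff hz).1 (F.reduced_le_tame hz 0 hc)
  obtain ⟨l, hl⟩ := key ha
  obtain ⟨m, hm⟩ := key hb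
  obtain ⟨n, hn⟩ := key hc
  -- The stages are monotone, so the largest of the three serves all elements.
  obtain ⟨v, hv, h⟩ := F.exists_conj_mem_tameBase hz (max l (max m n)) 0
  have h1 : ∀ c ∈ tameAfter κ EA S ![z₁, z₂] (max l (max m n)) 0,
      star (v * (z₁ * z₂') * z₁) * c * (v * (z₁ * z₂') * z₁) ∈ diagWord κ EA S 0 := by
    intro c hc
    have := F.conj_mem_diagWord hz₁ (F.conj_tameBase hz hz₂' h0 (h c hc))
    simpa [mul_assoc] using this
  refine ⟨_, (hv.mul (hz₁.commUnitary.mul hz₂'.commUnitary)).mul hz₁.commUnitary,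
    h1 _ ?_, h1 _ ?_, h1 _ ?_⟩
  · exact F.tameAfter_mono hz 0 (le_max_left _ _) hl
  · exact F.tameAfter_mono hz 0 ((le_max_left _ _).trans (le_max_right _ _)) hm
  · exact F.tameAfter_mono hz 0 ((le_max_right _ _).trans (le_max_right _ _)) hn

end FreePair

end DiagWord
-- `u b v - ρ` is invertible; undoing the unitaries moves `b` by `ρ` times a unitary.
theorem exists_isUnit_of_unitary_mul {C : Type*} [CStarAlgebra C] {u v b : C} {ρ : ℝ} {n : ℕ}
    (hu : u ∈ unitary C) (hv : v ∈ unitary C) (hρ : 0 < ρ) (h : ‖(u * b * v) ^ n‖ < ρ ^ n) :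
    ∃ g : C, IsUnit g ∧ ‖b - g‖ ≤ ρ := by
  rcases subsingleton_or_nontrivial C with _ | _
  · exact ⟨1, isUnit_one, by rw [Subsingleton.elim (b - 1) 0, norm_zero]; exact hρ.le⟩
  have hu' : star u ∈ unitary C := Unitary.star_mem hu
  have hv' : star v ∈ unitary C := Unitary.star_mem hv
  have hU : IsUnit (star u) := isUnit_iff_exists.2 ⟨u, hu.1, hu.2⟩
  have hV : IsUnit (star v) := isUnit_iff_exists.2 ⟨v, hv.1, hv.2⟩
  refine ⟨star u * (u * b * v - algebraMap ℂ C ρ) * star v,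
    (hU.mul (isUnit_sub_of_norm_pow_lt h)).mul hV, ?_⟩
  have h1 : b - star u * (u * b * v - algebraMap ℂ C ρ) * star v
      = (ρ : ℂ) • (star u * star v) := by
    have h2 : star u * (u * b * v) * star v = b := by
      calc _ = (star u * u) * b * (v * star v) := by simp only [mul_assoc]
        _ = b := by rw [hu.1, hv.2, one_mul, mul_one]
    rw [mul_sub, sub_mul, h2, ← Algebra.commutes, mul_assoc, ← Algebra.smul_def]
    abel
  rw [h1, norm_smul, CStarRing.norm_of_mem_unitary (mul_mem hu' hv'), mul_one, Complex.norm_real,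
    Real.norm_of_nonneg hρ.le]

/-! ### Spectral radius in terms of the 2-norm -/

section Bound

variable {A : Type*} [CStarAlgebra A]
variable {κ : (Fin 2 → ℂ) →⋆ₐ[ℂ] A} {EA : A →ₗ[ℂ] (Fin 2 → ℂ)} {S : Fin 2 → StarSubalgebra ℂ A}

/-- The sum of the coordinates of `EA`. -/
noncomputable def expTrace (EA : A →ₗ[ℂ] (Fin 2 → ℂ)) : A →ₗ[ℂ] ℂ :=
  ∑ k, LinearMap.proj k ∘ₗ EA

theorem expTrace_apply (a : A) : expTrace EA a = ∑ k, EA a k := by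
  simp [expTrace]

/-- The span of the words with first letter in `S i`. -/
noncomputable def leftSpan (EA : A →ₗ[ℂ] (Fin 2 → ℂ)) (S : Fin 2 → StarSubalgebra ℂ A)
    (i : Fin 2) : Submodule ℂ A :=
  wordSpan EA S i 0 ⊔ wordSpan EA S i 1

theorem mul_mem_leftSpan {i j : Fin 2} {a m : A} (ha : a ∈ wordSpan EA S i j)
    (hm : m ∈ leftSpan EA S (j + 1)) : a * m ∈ leftSpan EA S i := by
  obtain ⟨m, h1, n, h2, rfl⟩ := Submodule.mem_sup.1 hm
  rw [mul_add]
  exact Submodule.add_mem_sup (wordSpan_mul ha h1) (wordSpan_mul ha h2)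

theorem wordSpan_le_leftSpan (i j : Fin 2) : wordSpan EA S i j ≤ leftSpan EA S i := by
  revert j
  exact Fin.forall_fin_two.2 ⟨le_sup_left, le_sup_right⟩

/-- The sum of `ℂ²` and of the span of the words with first letter in `S i`. -/
noncomputable def leftSpanIncl (κ : (Fin 2 → ℂ) →⋆ₐ[ℂ] A) (EA : A →ₗ[ℂ] (Fin 2 → ℂ))
    (S : Fin 2 → StarSubalgebra ℂ A) (i : Fin 2) : Submodule ℂ A :=
  LinearMap.range κ.toAlgHom.toLinearMap ⊔ leftSpan EA S i

theorem reduced_le_sup : reduced κ EA S ≤ leftSpan EA S 1 ⊔ leftSpanIncl κ EA S 0 := by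
  refine Submodule.span_le.2 ?_
  rintro _ (⟨d, rfl⟩ | ⟨i, j, n, hw⟩)
  · exact Submodule.mem_sup_right (Submodule.mem_sup_left ⟨d, rfl⟩)
  · have h1 := wordSpan_le_leftSpan i j hw.mem_wordSpan
    revert h1
    clear hw
    revert i
    exact Fin.forall_fin_two.2 ⟨fun h => Submodule.mem_sup_right (Submodule.mem_sup_right h),
      fun h => Submodule.mem_sup_left h⟩

namespace FreePair

variable (F : FreePair κ EA S)
include F

/-- `star m` is spanned by words ending in `S 1`, so the products are again alternating words. This
is the orthogonality of the two subspaces for which `x` is triangular. -/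
theorem expect_star_mul_eq_zero {m n : A} (hm : m ∈ leftSpan EA S 1)
    (hn : n ∈ leftSpanIncl κ EA S 0) : EA (star m * n) = 0 := by
  obtain ⟨_, ⟨d, rfl⟩, l, hl, rfl⟩ := Submodule.mem_sup.1 hn
  obtain ⟨l₀, hl₀, l₁, hl₁, rfl⟩ := Submodule.mem_sup.1 hl
  have h1 : ∀ j, ∀ a ∈ wordSpan EA S 1 j, EA (star a * (κ d + (l₀ + l₁))) = 0 := by
    intro j a ha
    have h2 := F.wordSpan_star ha
    rw [mul_add, map_add, F.expect_mul_incl, F.expect_wordSpan h2, zero_mul, zero_add,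
      mul_add, map_add, F.expect_wordSpan (wordSpan_mul' one_ne_zero h2 hl₀),
      F.expect_wordSpan (wordSpan_mul' one_ne_zero h2 hl₁), add_zero]
  obtain ⟨m₀, hm₀, m₁, hm₁, rfl⟩ := Submodule.mem_sup.1 hm
  rw [star_add, add_mul, map_add]
  exact (congrArg₂ _ (h1 _ _ hm₀) (h1 _ _ hm₁)).trans (add_zero _)

omit F in
-- Only the part of `c` in `ℂ²` is seen by `y`, and `r² - EA c` has a square root `e` in `ℂ²`; the
-- claim is the positivity of `τ` at `κ e * y`.
theorem expTrace_conj_le {c y : A} {r : ℝ} (hpos : ∀ a, 0 ≤ expTrace EA (star a * a))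
    (hc : ∀ k, EA c k ≤ (r : ℂ) ^ 2) (hy : EA (star y * ((c - κ (EA c)) * y)) = 0) :
    (expTrace EA (star y * (c * y))).re ≤ r ^ 2 * (expTrace EA (star y * y)).re := by
  let e : Fin 2 → ℂ := fun k => ((√((r : ℂ) ^ 2 - EA c k).re : ℝ) : ℂ)
  have he : star e * e = algebraMap ℂ _ ((r : ℂ) ^ 2) - EA c := by
    ext k
    have h1 := sub_nonneg.2 (hc k)
    have h2 : ((((r : ℂ) ^ 2 - EA c k).re : ℝ) : ℂ) = (r : ℂ) ^ 2 - EA c k := by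
      refine Complex.ext (by simp) ?_
      exact (Complex.le_def.1 h1).2
    simp only [Pi.mul_apply, Pi.star_apply, e, Complex.star_def, Complex.conj_ofReal, Pi.sub_apply,
      Pi.algebraMap_apply, Algebra.algebraMap_self, RingHom.id_apply]
    rw [← Complex.ofReal_mul, Real.mul_self_sqrt (Complex.le_def.1 h1).1, h2]
  have h1 : star (κ e * y) * (κ e * y) = (r : ℂ) ^ 2 • (star y * y) - star y * (c * y)
      + star y * ((c - κ (EA c)) * y) := by
    have h2 : κ (star e * e) = algebraMap ℂ A ((r : ℂ) ^ 2) - κ (EA c) := by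
      rw [he, map_sub, AlgHomClass.commutes]
    calc _ = star y * (κ (star e * e) * y) := by
          rw [star_mul, ← map_star, map_mul]; simp only [mul_assoc]
      _ = _ := by
          rw [h2, sub_mul, sub_mul, mul_sub, mul_sub, ← Algebra.smul_def, mul_smul_comm]; abel
  have h2 := hpos (κ e * y)
  have h3 : expTrace EA (star y * ((c - κ (EA c)) * y)) = 0 := by
    rw [expTrace_apply, hy]; simp
  rw [h1, map_add, h3, add_zero, map_sub, map_smul, smul_eq_mul] at h2
  have h4 := (Complex.le_def.1 h2).1
  rw [← Complex.ofReal_pow, Complex.sub_re, Complex.re_ofReal_mul] at h4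
  simpa using h4

/-- In the GNS representation of `τ`, `norm_pow_le_of_triangular` applies to the words starting in
`S 1`, which `x` preserves because its words end in `S 0`, and to `ℂ²` plus the words starting in `S
0`. The representation is isometric, so the bound holds in `A`. -/
theorem exists_norm_pow_le {x : A} {r : ℝ} (hr : 0 < r)
    (hpos : ∀ a, 0 ≤ expTrace EA (star a * a))
    (hfaith : ∀ a, (∀ y, expTrace EA (star (a * y) * (a * y)) = 0) → a = 0)
    (hdense : (reduced κ EA S).topologicalClosure = ⊤)
    (hx : x ∈ wordSpan EA S 1 0)
    (hxx : star x * x ∈ diagWord κ EA S 0) (hxx' : x * star x ∈ diagWord κ EA S 1)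
    (hle : ∀ k, EA (star x * x) k ≤ (r : ℂ) ^ 2) (hle' : ∀ k, EA (x * star x) k ≤ (r : ℂ) ^ 2) :
    ∃ K, ∀ n : ℕ, ‖x ^ n‖ ≤ (2 + n * K) * r ^ n := by
  obtain ⟨G, _, _, _, π, ξ, hπ, hξ⟩ := exists_gns (expTrace EA) hpos
  have hinner : ∀ a b, ⟪π a ξ, π b ξ⟫_ℂ = expTrace EA (star a * b) := by
    intro a b
    rw [← hπ, map_mul, map_star, ContinuousLinearMap.star_eq_adjoint]
    exact (ContinuousLinearMap.adjoint_inner_right _ _ _).symm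
  have hnorm : ∀ a, ‖π a ξ‖ ^ 2 = (expTrace EA (star a * a)).re := by
    intro a
    rw [← hinner, inner_self_eq_norm_sq_to_K]
    norm_cast
  have hinj : Function.Injective π := by
    rw [injective_iff_map_eq_zero]
    intro a ha
    refine hfaith a fun y => ?_
    rw [← hinner, map_mul, ha]
    simp
  have hle_of : ∀ {a y : A}, (∀ k, EA (star a * a) k ≤ (r : ℂ) ^ 2) →
      EA (star y * ((star a * a - κ (EA (star a * a))) * y)) = 0 →
      ‖π a (π y ξ)‖ ≤ r * ‖π y ξ‖ := by
    intro a y h1 h2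
    have h3 := expTrace_conj_le hpos h1 h2
    have h4 : π a (π y ξ) = π (a * y) ξ := by rw [map_mul]; rfl
    refine (sq_le_sq₀ (norm_nonneg _) (by positivity)).1 ?_
    rw [mul_pow, h4, hnorm, hnorm, star_mul]
    simpa only [mul_assoc] using h3
  let ev : A →ₗ[ℂ] G :=
    { toFun := fun a => π a ξ, map_add' := fun a b => by simp, map_smul' := fun c a => by simp }
  have hev : Continuous ev := by
    have h1 : Continuous π := (NonUnitalStarAlgHom.isometry π hinj).continuous
    exact h1.clm_apply continuous_const
  have hT := norm_pow_le_of_triangular (W := (leftSpan EA S 1).map ev)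
    (W' := (leftSpanIncl κ EA S 0).map ev) (T := π x) hr
    (by
      rintro _ ⟨m, hm, rfl⟩ _ ⟨n, hn, rfl⟩
      change ⟪π m ξ, π n ξ⟫_ℂ = 0
      rw [hinner, expTrace_apply, F.expect_star_mul_eq_zero hm hn]
      simp)
    (by
      rw [← Submodule.map_sup]
      have h1 : (reduced κ EA S).topologicalClosure ≤
          (((leftSpan EA S 1 ⊔ leftSpanIncl κ EA S 0).map ev).topologicalClosure).comap ev := by
        refine Submodule.topologicalClosure_minimal _ ?_
          ((Submodule.isClosed_topologicalClosure _).preimage hev)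
        exact fun a ha => Submodule.le_topologicalClosure _ ⟨a, reduced_le_sup ha, rfl⟩
      rw [hdense] at h1
      rw [eq_top_iff]
      intro g _
      have h2 : (Set.range fun b => π b ξ) ⊆
          (((leftSpan EA S 1 ⊔ leftSpanIncl κ EA S 0).map ev).topologicalClosure : Set G) := by
        rintro _ ⟨a, rfl⟩
        exact h1 (Submodule.mem_top (x := a))
      exact closure_minimal h2 (Submodule.isClosed_topologicalClosure _) (hξ g))
    (by
      rintro _ ⟨m, hm, rfl⟩
      refine ⟨x * m, mul_mem_leftSpan hx hm, ?_⟩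
      change π (x * m) ξ = π x (π m ξ)
      rw [map_mul]; rfl)
    (by
      rintro _ ⟨m, hm, rfl⟩
      -- The noncentral part of `x* x` sends words starting in `S 1` to words starting in `S 0`,
      -- which are orthogonal to them.
      refine hle_of hle (F.expect_star_mul_eq_zero hm (Submodule.mem_sup_right ?_))
      exact mul_mem_leftSpan hxx hm)
    (by
      rintro _ ⟨n, hn, rfl⟩
      rw [← map_star]
      refine hle_of (by simpa using hle') ?_
      -- Dually, the noncentral part of `x x*` moves `n` to the span of words starting in `S 1`; the
      -- adjoint puts the two factors in the order of the orthogonality lemma.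
      rw [star_star, ← star_star (star n * _), F.star_apply, star_mul, star_star,
        F.expect_star_mul_eq_zero ?_ hn, star_zero]
      obtain ⟨_, ⟨d, rfl⟩, l, hl, rfl⟩ := Submodule.mem_sup.1 hn
      rw [mul_add]
      exact add_mem (wordSpan_le_leftSpan _ _ (F.wordSpan_mul_incl d hxx'))
        (mul_mem_leftSpan hxx' hl))
  refine ⟨‖π x‖ / r, fun n => ?_⟩
  rw [← NonUnitalStarAlgHom.norm_map π hinj, map_pow]
  exact hT n

end FreePair

end Bound

/-! ### The trace of the free product and its faithfulness -/

section Trace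

variable {A : Type*} [CStarAlgebra A]
variable {κ : (Fin 2 → ℂ) →⋆ₐ[ℂ] A} {EA : A →ₗ[ℂ] (Fin 2 → ℂ)} {S : Fin 2 → StarSubalgebra ℂ A}

theorem star_apply_of_positive {φ : A →ₗ[ℂ] ℂ} (hφ : ∀ a, 0 ≤ φ (star a * a)) (a : A) :
    φ (star a) = star (φ a) := by
  obtain ⟨G, _, _, _, π, ξ, hπ, -⟩ := exists_gns φ hφ
  rw [← hπ, ← hπ, map_star, ContinuousLinearMap.star_eq_adjoint,
    ContinuousLinearMap.adjoint_inner_right]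
  exact (inner_conj_symm _ _).symm

theorem continuous_of_positive {φ : A →ₗ[ℂ] ℂ} (hφ : ∀ a, 0 ≤ φ (star a * a)) :
    Continuous φ := by
  obtain ⟨G, _, _, _, π, ξ, hπ, -⟩ := exists_gns φ hφ
  have h1 : Continuous π :=
    (AddMonoidHomClass.lipschitz_of_bound π 1 fun a => by
      rw [one_mul]; exact NonUnitalStarAlgHom.norm_apply_le π a).continuous
  have h2 : Continuous fun a => ⟪ξ, π a ξ⟫_ℂ :=
    continuous_const.inner (h1.clm_apply continuous_const)
  simpa only [hπ] using h2

namespace IsConditionalExpectation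

theorem apply_nonneg (hE : IsConditionalExpectation κ EA) (a : A) (k : Fin 2) :
    0 ≤ EA (star a * a) k := by
  obtain ⟨c, hc⟩ := hE.positive a
  rw [hc]
  exact star_mul_self_nonneg (c k)

theorem expTrace_nonneg (hE : IsConditionalExpectation κ EA) (a : A) :
    0 ≤ expTrace EA (star a * a) := by
  rw [expTrace_apply]
  exact Finset.sum_nonneg fun k _ => hE.apply_nonneg a k

theorem star_apply (hE : IsConditionalExpectation κ EA) (a : A) : EA (star a) = star (EA a) := by
  ext k
  exact star_apply_of_positive (φ := LinearMap.proj k ∘ₗ EA) (fun a => hE.apply_nonneg a k) a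

end IsConditionalExpectation

namespace FreePair

variable (F : FreePair κ EA S)
include F

/-- Length at least 2 matters: after `x` merges with the first letter, a nonempty word remains to
absorb the expectation. -/
theorem expect_letter_mul_word {i j k : Fin 2} {n : ℕ} {x y : A} (hx : x ∈ S i) (h0 : EA x = 0)
    (hy : IsWord EA S j k (n + 2) y) : EA (x * y) = 0 := by
  rcases fin_two_eq_or j i with rfl | rfl
  · cases hy with
    | cons ha _ hw =>
      obtain ⟨e, d, he, h1, h2⟩ := F.exists_centred (mul_mem hx ha)
      rw [← mul_assoc, h2, add_mul, map_add, F.expect_word (.cons he h1 hw),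
        F.expect_word (F.word_incl_mul d hw), add_zero]
  · exact F.expect_word (.cons hx h0 hy)

/-- For words `y`, both sides vanish by freeness unless `y` is a single letter from the same
algebra, where the given trace applies. -/
theorem expTrace_letter_mul {i : Fin 2} {x y : A} (hx : x ∈ S i) (h0 : EA x = 0)
    (hy : y ∈ reduced κ EA S) : expTrace EA (x * y) = expTrace EA (y * x) := by
  induction hy using Submodule.span_induction with
  | mem y hy =>
    rcases hy with ⟨d, rfl⟩ | ⟨j, k, n, hy⟩
    · rw [expTrace_apply, expTrace_apply, F.expect_incl_mul, F.expect_mul_incl, mul_comm]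
    · rcases n with _ | _ | n
      · cases hy
      · obtain ⟨hy, hy0⟩ : y ∈ S j ∧ EA y = 0 := by
          cases hy with
          | letter hy h => exact ⟨hy, h⟩
          | cons _ _ hw => cases hw
        rw [expTrace_apply, expTrace_apply]
        rcases fin_two_eq_or j i with rfl | rfl
        · exact F.tracial _ _ hx _ hy
        · have h1 := IsWord.cons hx h0 (.letter hy hy0)
          have h2 := F.word_star (IsWord.cons (star_mem hx) (by rw [F.star_apply, h0, star_zero])
            (F.word_star (.letter hy hy0)))
          rw [star_mul, star_star, star_star] at h2
          rw [F.expect_word h1, F.expect_word h2]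
      · have h1 := F.expect_letter_mul_word hx h0 hy
        have h2 := F.expect_letter_mul_word (star_mem hx) (by rw [F.star_apply, h0, star_zero])
          (F.word_star hy)
        rw [← star_mul, F.star_apply, star_eq_zero] at h2
        rw [expTrace_apply, expTrace_apply, h1, h2]
  | zero => simp
  | add a b _ _ ha hb => rw [mul_add, add_mul, map_add, map_add, ha, hb]
  | smul c a _ ha => rw [mul_smul_comm, smul_mul_assoc, map_smul, map_smul, ha]

theorem expTrace_mul_comm (hpos : ∀ a, 0 ≤ expTrace EA (star a * a))
    (hdense : (StarAlgebra.adjoin ℂ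
      (Set.range κ ∪ ⋃ i, (S i : Set A))).topologicalClosure = ⊤) (a b : A) :
    expTrace EA (a * b) = expTrace EA (b * a) := by
  have hcont := continuous_of_positive hpos
  have hd : Dense (StarAlgebra.adjoin ℂ (Set.range κ ∪ ⋃ i, (S i : Set A)) : Set A) := by
    intro a
    have h1 : a ∈ (StarAlgebra.adjoin ℂ
      (Set.range κ ∪ ⋃ i, (S i : Set A))).topologicalClosure := by rw [hdense]; trivial
    exact h1
  have hincl : ∀ d b, expTrace EA (κ d * b) = expTrace EA (b * κ d) := fun d b => by
    rw [expTrace_apply, expTrace_apply, F.expect_incl_mul, F.expect_mul_incl, mul_comm]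
  have h1 : ∀ a ∈ StarAlgebra.adjoin ℂ (Set.range κ ∪ ⋃ i, (S i : Set A)),
      ∀ b, expTrace EA (a * b) = expTrace EA (b * a) := by
    intro a ha
    induction ha using StarAlgebra.adjoin_induction with
    | mem x hx =>
      rcases hx with ⟨d, rfl⟩ | hx
      · exact hincl d
      · obtain ⟨i, hx⟩ := Set.mem_iUnion.1 hx
        obtain ⟨e, d, he, he0, rfl⟩ := F.exists_centred hx
        intro b
        have hb : b ∈ closure (StarAlgebra.adjoin ℂ
          (Set.range κ ∪ ⋃ i, (S i : Set A)) : Set A) := hd b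
        have h2 : expTrace EA (e * b) = expTrace EA (b * e) := by
          refine closure_minimal (t := {b | expTrace EA (e * b) = expTrace EA (b * e)})
            (fun c hc => F.expTrace_letter_mul he he0 (F.adjoin_le_reduced hc)) ?_ hb
          exact isClosed_eq (by fun_prop) (by fun_prop)
        rw [add_mul, mul_add, map_add, map_add, h2, hincl]
    | algebraMap r => intro b; rw [Algebra.commutes]
    | add x y _ _ hx hy => intro b; rw [add_mul, mul_add, map_add, map_add, hx, hy]
    | mul x y _ _ hx hy => intro b; rw [mul_assoc, hx, mul_assoc, hy, mul_assoc]
    | star x _ hx =>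
      intro b
      have h2 := congrArg star (hx (star b))
      rw [← star_apply_of_positive hpos, ← star_apply_of_positive hpos] at h2
      simpa using h2.symm
  refine closure_minimal (t := {a | expTrace EA (a * b) = expTrace EA (b * a)})
    (fun c hc => h1 c hc b) ?_ (hd a)
  exact isClosed_eq (by fun_prop) (by fun_prop)

end FreePair

/-- By traciality `τ((a x)* (a x)) = τ(x x* a* a)`, which vanishes because `a` kills the GNS vector.
So `a` acts as zero on `L²(A, EA)`. -/
theorem eq_zero_of_expTrace_eq_zero (hE : IsConditionalExpectation κ EA)
    (hfaith : ∀ a, (∀ x, EA (star (a * x) * (a * x)) = 0) → a = 0)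
    (hcomm : ∀ a b, expTrace EA (a * b) = expTrace EA (b * a)) {a : A}
    (ha : expTrace EA (star a * a) = 0) : a = 0 := by
  have hsum : ∀ y, expTrace EA (star y * y) = 0 → EA (star y * y) = 0 := by
    intro y hy
    rw [expTrace_apply, Finset.sum_eq_zero_iff_of_nonneg fun k _ => hE.apply_nonneg y k] at hy
    ext k
    exact hy k (Finset.mem_univ k)
  refine hfaith a fun x => hsum _ ?_
  obtain ⟨G, _, _, _, π, ξ, hπ, -⟩ := exists_gns (expTrace EA) hE.expTrace_nonneg
  have h1 : π a ξ = 0 := by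
    rw [← inner_self_eq_zero (𝕜 := ℂ), ← ContinuousLinearMap.adjoint_inner_right,
      ← ContinuousLinearMap.star_eq_adjoint, ← map_star, ← ha, ← hπ, map_mul]
    rfl
  have h2 : star (a * x) * (a * x) = star x * (star a * a * x) := by
    rw [star_mul]; simp only [mul_assoc]
  rw [h2, hcomm, mul_assoc, hcomm, ← mul_assoc, ← hπ, map_mul]
  change ⟪ξ, π _ (π a ξ)⟫_ℂ = 0
  rw [h1, map_zero, inner_zero_right]

end Trace
-- The exponent is positive because powers in a corner agree with those in `A` only then: the zeroth
-- power is the projection.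
theorem exists_mul_pow_lt_pow {r ρ K : ℝ} (hr : 0 < r) (hrρ : r < ρ) :
    ∃ n : ℕ, (2 + (n + 1 : ℕ) * K) * r ^ (n + 1) < ρ ^ (n + 1) := by
  have hρ := hr.trans hrρ
  have h0 : 0 ≤ r / ρ := by positivity
  have h1 : r / ρ < 1 := (div_lt_one hρ).2 hrρ
  have h2 := ((tendsto_pow_atTop_nhds_zero_of_lt_one h0 h1).const_mul 2).add
    ((tendsto_self_mul_const_pow_of_lt_one h0 h1).const_mul K)
  have h3 := (Filter.tendsto_add_atTop_iff_nat 1).2 h2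
  obtain ⟨n, hn⟩ := (h3.eventually_lt_const (show (2 * 0 + K * 0 : ℝ) < 1 by norm_num)).exists
  refine ⟨n, ?_⟩
  rw [← div_lt_one (pow_pos hρ _), mul_div_assoc, ← div_pow]
  calc _ = _ := by ring
    _ < 1 := hn

/-! ### Stable rank one of the corners -/

section Corner

variable {A : Type*} [CStarAlgebra A]
variable {κ : (Fin 2 → ℂ) →⋆ₐ[ℂ] A} {EA : A →ₗ[ℂ] (Fin 2 → ℂ)} {S : Fin 2 → StarSubalgebra ℂ A}

theorem isSelfAdjoint_minProj (κ : (Fin 2 → ℂ) →⋆ₐ[ℂ] A) (k : Fin 2) :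
    IsSelfAdjoint (κ (minProj k)) := by
  rw [IsSelfAdjoint, ← map_star]
  congr 1
  ext l
  by_cases h : l = k
  · subst h; simp [minProj]
  · simp [minProj, h]

noncomputable instance minCornerCStarAlgebra (κ : (Fin 2 → ℂ) →⋆ₐ[ℂ] A) (k : Fin 2) :
    CStarAlgebra (minCorner κ k) :=
  cornerCStarAlgebra _ (isSelfAdjoint_minProj κ k)

theorem minCorner_pow_val {k : Fin 2} (X : minCorner κ k) (n : ℕ) :
    (X ^ (n + 1)).1 = X.1 ^ (n + 1) := by
  induction n with
  | zero => rw [zero_add, pow_one, pow_one]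
  | succ n ih =>
    rw [pow_succ, pow_succ X.1, ← ih]
    rfl

/-- The compression of an element to a corner. -/
noncomputable def compress (κ : (Fin 2 → ℂ) →⋆ₐ[ℂ] A) (k : Fin 2) (a : A) : minCorner κ k :=
  ⟨κ (minProj k) * a * κ (minProj k), a, rfl⟩

theorem compress_val {k : Fin 2} (a : A) :
    (compress κ k a).1 = κ (minProj k) * a * κ (minProj k) := rfl

theorem CommUnitary.compress_val {k : Fin 2} {w : A} (hw : CommUnitary κ w) :
    (compress κ k w).1 = κ (minProj k) * w := by
  rw [AmalgFree.compress_val, mul_assoc, ← hw.comm, ← mul_assoc,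
    (isIdempotentElem_minProj κ k).eq]

theorem CommUnitary.compress_val' {k : Fin 2} {w : A} (hw : CommUnitary κ w) :
    (compress κ k w).1 = w * κ (minProj k) := by
  rw [hw.compress_val, hw.comm]

theorem CommUnitary.compress_mem_unitary {w : A} (hw : CommUnitary κ w) (k : Fin 2) :
    compress κ k w ∈ unitary (minCorner κ k) := by
  have hp := (isSelfAdjoint_minProj κ k).star_eq
  have hi := (isIdempotentElem_minProj κ k).eq
  constructor
  · refine Subtype.ext ?_
    change Star.star (compress κ k w).1 * (compress κ k w).1 = κ (minProj k)
    rw [hw.compress_val', star_mul, hp, mul_assoc, ← mul_assoc _ w, hw.star_mul_self, one_mul, hi]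
  · refine Subtype.ext ?_
    change (compress κ k w).1 * Star.star (compress κ k w).1 = κ (minProj k)
    rw [hw.compress_val, star_mul, hp, mul_assoc, ← mul_assoc w, hw.mul_star_self, one_mul, hi]

theorem FreePair.exists_isUnit_near (F : FreePair κ EA S)
    (hpos : ∀ a k, 0 ≤ EA (star a * a) k)
    (hcomm : ∀ a b, expTrace EA (a * b) = expTrace EA (b * a))
    (hfaith : ∀ a, (∀ y, expTrace EA (star (a * y) * (a * y)) = 0) → a = 0)
    (hdense : (reduced κ EA S).topologicalClosure = ⊤) {z₁ z₂ z₂' : A}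
    (hz₁ : DiagUnitary κ EA S 0 z₁) (hz₂ : DiagUnitary κ EA S 1 z₂)
    (hz₂' : DiagUnitary κ EA S 1 z₂') (h0 : EA (star z₂ * z₂') = 0) {k : Fin 2}
    {b : minCorner κ k} (hb : b.1 ∈ reduced κ EA S) (hbb : star b.1 * b.1 ∈ reduced κ EA S)
    (hbb' : b.1 * star b.1 ∈ reduced κ EA S) {ρ : ℝ} (hρ : 0 < ρ)
    (hlt : (expTrace EA (star b.1 * b.1)).re < ρ ^ 2) :
    ∃ g : minCorner κ k, IsUnit g ∧ ‖b - g‖ ≤ ρ := by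
  have hpos' : ∀ a, 0 ≤ expTrace EA (star a * a) := fun a => by
    rw [expTrace_apply]; exact Finset.sum_nonneg fun k _ => hpos a k
  obtain ⟨r, hr1, hrρ⟩ := exists_between ((Real.sqrt_lt' hρ).2 hlt)
  have hr : 0 < r := (Real.sqrt_nonneg _).trans_lt hr1
  have hr2 : expTrace EA (star b.1 * b.1) ≤ (r : ℂ) ^ 2 := by
    rw [← Complex.ofReal_pow, Complex.le_def]
    rw [Complex.ofReal_re, Complex.ofReal_im]
    exact ⟨((Real.sqrt_lt' hr).1 hr1).le, (Complex.le_def.1 (hpos' b.1)).2.symm⟩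
  obtain ⟨v, hv, h1, h2, h3⟩ := F.exists_conj_mem_diagWord hz₁ hz₂ hz₂' h0 hb hbb hbb'
  have hL : CommUnitary κ (star z₂' * star v) := hz₂'.commUnitary.star.mul hv.star
  have hR : CommUnitary κ (v * (z₂ * z₁)) := hv.mul (hz₂.commUnitary.mul hz₁.commUnitary)
  -- The left factor `z₂'*` and the right factor `z₂ z₁` differ on purpose: they make `x` start in
  -- `S 1` and end in `S 0`, where a common conjugation would leave the `ℂ²` part of `v* b v` in
  -- `ℂ²`. Here that part yields `(z₂'* z₂) z₁`, a word since `EA(z₂'* z₂) = 0`.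
  set x := star z₂' * star v * b.1 * (v * (z₂ * z₁)) with hx
  have hxx : star x * x = star (z₂ * z₁) * (star v * (star b.1 * b.1) * v) * (z₂ * z₁) := by
    calc _ = star (v * (z₂ * z₁)) * star b.1 * (star (star z₂' * star v) * (star z₂' * star v))
          * b.1 * (v * (z₂ * z₁)) := by
          rw [hx, star_mul, star_mul (star z₂' * star v)]; simp only [mul_assoc]
      _ = _ := by rw [hL.star_mul_self, mul_one, star_mul v]; simp only [mul_assoc]
  have hxx' : x * star x = star z₂' * (star v * (b.1 * star b.1) * v) * z₂' := by
    calc _ = star z₂' * star v * b.1 * ((v * (z₂ * z₁)) * star (v * (z₂ * z₁))) * star b.1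
          * star (star z₂' * star v) := by
          rw [hx, star_mul, star_mul (star z₂' * star v)]; simp only [mul_assoc]
      _ = _ := by
          rw [hR.mul_star_self, mul_one, star_mul (star z₂'), star_star, star_star]
          simp only [mul_assoc]
  have hx10 : x ∈ wordSpan EA S 1 0 := by
    set c := star v * b.1 * v with hc
    have h4 : x = star z₂' * ((c - κ (EA c)) * (z₂ * z₁)) + κ (EA c) * ((star z₂' * z₂) * z₁) := by
      rw [sub_mul, mul_sub, ← mul_assoc _ (κ _), ← hz₂'.star_comm]
      simp only [hx, hc, mul_assoc]
      abel
    rw [h4]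
    refine add_mem ?_ (F.wordSpan_incl_mul _ (IsWord.cons (n := 1)
      (mul_mem (star_mem hz₂'.mem) hz₂.mem) ?_ (.letter hz₁.mem hz₁.expect)).mem_wordSpan)
    · refine wordSpan_mul (hz₂'.star_isWord F).mem_wordSpan
        (wordSpan_mul' zero_ne_one h1 (IsWord.cons (n := 1) hz₂.mem hz₂.expect
          (.letter hz₁.mem hz₁.expect)).mem_wordSpan)
    · rw [← star_star (star z₂' * z₂), F.star_apply, star_mul, star_star, h0, star_zero]
  have htr : expTrace EA (star x * x) = expTrace EA (star b.1 * b.1) := by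
    have h4 : star x * x = star (v * (z₂ * z₁)) * ((star b.1 * b.1) * (v * (z₂ * z₁))) := by
      rw [hxx, star_mul v]; simp only [mul_assoc]
    rw [h4, hcomm, mul_assoc, hR.mul_star_self, mul_one]
  -- Each coordinate of a positive expectation is at most their sum `τ`.
  have hle : ∀ {y : A}, expTrace EA (star y * y) ≤ (r : ℂ) ^ 2 →
      ∀ l, EA (star y * y) l ≤ (r : ℂ) ^ 2 := by
    intro y hy l
    refine le_trans ?_ hy
    rw [expTrace_apply]
    exact Finset.single_le_sum (f := fun l => EA (star y * y) l) (fun l _ => hpos y l)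
      (Finset.mem_univ l)
  obtain ⟨K, hK⟩ := F.exists_norm_pow_le hr hpos' hfaith hdense hx10
    (by
      rw [hxx, star_mul z₂]
      have h5 := F.conj_mem_diagWord (i := 0) hz₁ (F.conj_mem_diagWord (i := 1) hz₂ h2)
      simpa only [mul_assoc] using h5)
    (by rw [hxx']; exact F.conj_mem_diagWord (i := 1) hz₂' h3)
    (hle (htr ▸ hr2))
    (by
      have h6 := hle (y := star x) (by rw [star_star, hcomm, htr]; exact hr2)
      simpa only [star_star] using h6)
  obtain ⟨n, hn⟩ := exists_mul_pow_lt_pow (K := K) hr hrρ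
  refine exists_isUnit_of_unitary_mul (hL.compress_mem_unitary k) (hR.compress_mem_unitary k) hρ
    (n := n + 1) ?_
  have h7 : (compress κ k (star z₂' * star v) * b * compress κ k (v * (z₂ * z₁))).1 = x := by
    change (compress κ k (star z₂' * star v)).1 * b.1 * (compress κ k (v * (z₂ * z₁))).1 = x
    rw [hL.compress_val', hR.compress_val, mul_assoc _ _ b.1, corner_mul_left, mul_assoc,
      ← mul_assoc b.1, corner_mul_right, ← mul_assoc]
  change ‖(_ ^ (n + 1) : minCorner κ k).1‖ < _
  rw [minCorner_pow_val, h7]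
  exact (hK _).trans_lt hn

theorem FreePair.hasStableRankOne (F : FreePair κ EA S) (hE : IsConditionalExpectation κ EA)
    (hgen : (StarAlgebra.adjoin ℂ (Set.range κ ∪ ⋃ i, (S i : Set A))).topologicalClosure = ⊤)
    (hfaith : ∀ a, (∀ x, EA (star (a * x) * (a * x)) = 0) → a = 0) {z₁ z₂ z₂' : A}
    (hz₁ : DiagUnitary κ EA S 0 z₁) (hz₂ : DiagUnitary κ EA S 1 z₂)
    (hz₂' : DiagUnitary κ EA S 1 z₂') (h0 : EA (star z₂ * z₂') = 0) (k : Fin 2) :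
    HasStableRankOne (minCorner κ k) := by
  have hcomm := F.expTrace_mul_comm hE.expTrace_nonneg hgen
  have hzero : ∀ a, expTrace EA (star a * a) = 0 → a = 0 := fun a =>
    eq_zero_of_expTrace_eq_zero hE hfaith hcomm
  have hfaith' : ∀ a, (∀ y, expTrace EA (star (a * y) * (a * y)) = 0) → a = 0 := fun a h =>
    hzero a (by simpa using h 1)
  have hmem : ∀ a, a ∈ closure
      (StarAlgebra.adjoin ℂ (Set.range κ ∪ ⋃ i, (S i : Set A)) : Set A) := by
    intro a
    have h1 : a ∈ (StarAlgebra.adjoin ℂ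
      (Set.range κ ∪ ⋃ i, (S i : Set A))).topologicalClosure := by rw [hgen]; trivial
    exact h1
  have hdense : (reduced κ EA S).topologicalClosure = ⊤ := by
    rw [eq_top_iff]
    intro a _
    exact closure_mono (fun c hc => F.adjoin_le_reduced hc) (hmem a)
  let τ : minCorner κ k →ₗ[ℂ] ℂ :=
    { toFun := fun X => expTrace EA X.1
      map_add' := fun X Y => map_add (expTrace EA) X.1 Y.1
      map_smul' := fun c X => map_smul (expTrace EA) c X.1 }
  have hτ : IsFaithfulTrace τ :=
    { tracial := fun X Y => hcomm X.1 Y.1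
      nonneg := fun X => hE.expTrace_nonneg X.1
      faithful := fun X hX => Subtype.ext (hzero X.1 hX) }
  have hτ1 : τ 1 = 1 := by
    change expTrace EA (κ (minProj k)) = 1
    rw [expTrace_apply, hE.apply_incl]
    simp [minProj]
  refine dense_isUnit_of_trace τ hτ hτ1 fun b ρ hρ hb => ?_
  -- The slack `ρ - ρ'` pays for replacing `b` by a compressed element of the dense star algebra,
  -- where the previous result applies with `ρ'`.
  obtain ⟨ρ', h1, h2⟩ := exists_between ((Real.sqrt_lt' hρ).2 hb)
  have hρ' : 0 < ρ' := (Real.sqrt_nonneg _).trans_lt h1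
  have hcont := continuous_of_positive hE.expTrace_nonneg
  set p := κ (minProj k) with hp
  have hbp : p * b.1 * p = b.1 := by rw [corner_mul_left, corner_mul_right]
  have hcorner : Continuous fun c : A => star (p * c * p) * (p * c * p) := by fun_prop
  have hdist : Continuous fun c : A => ‖b.1 - p * c * p‖ := by fun_prop
  have hopen : IsOpen {c : A | (expTrace EA (star (p * c * p) * (p * c * p))).re < ρ' ^ 2 ∧
      ‖b.1 - p * c * p‖ < ρ - ρ'} :=
    (isOpen_lt (Complex.continuous_re.comp (hcont.comp hcorner)) continuous_const).inter
      (isOpen_lt hdist continuous_const)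
  obtain ⟨c, ⟨hc1, hc2⟩, hc⟩ := mem_closure_iff.1 (hmem b.1) _ hopen
    ⟨by rw [hbp]; exact (Real.sqrt_lt' hρ').1 h1, by rw [hbp, sub_self, norm_zero]; linarith⟩
  have hpm : p ∈ StarAlgebra.adjoin ℂ (Set.range κ ∪ ⋃ i, (S i : Set A)) :=
    StarAlgebra.subset_adjoin _ _ (Or.inl ⟨_, rfl⟩)
  have hpc : p * c * p ∈ StarAlgebra.adjoin ℂ (Set.range κ ∪ ⋃ i, (S i : Set A)) :=
    mul_mem (mul_mem hpm hc) hpm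
  obtain ⟨g, hg, hgc⟩ := F.exists_isUnit_near hE.apply_nonneg hcomm hfaith' hdense hz₁ hz₂ hz₂' h0
    (b := compress κ k c) (F.adjoin_le_reduced hpc)
    (F.adjoin_le_reduced (mul_mem (star_mem hpc) hpc))
    (F.adjoin_le_reduced (mul_mem hpc (star_mem hpc))) hρ' hc1
  refine ⟨g, hg, ?_⟩
  have h3 : ‖b - compress κ k c‖ ≤ ρ - ρ' := hc2.le
  calc ‖b - g‖ = ‖(b - compress κ k c) + (compress κ k c - g)‖ := by congr 1; abel
    _ ≤ _ := norm_add_le _ _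
    _ ≤ ρ := by linarith

end Corner

/-! ### From the reduced free product to a free pair -/

section FreeProduct

variable {B : Fin 2 → Type*} [∀ i, CStarAlgebra (B i)] {ι : ∀ i, (Fin 2 → ℂ) →⋆ₐ[ℂ] B i}
  {E : ∀ i, B i →ₗ[ℂ] (Fin 2 → ℂ)} {A : Type*} [CStarAlgebra A] {κ : (Fin 2 → ℂ) →⋆ₐ[ℂ] A}
  {j : ∀ i, B i →⋆ₐ[ℂ] A} {EA : A →ₗ[ℂ] (Fin 2 → ℂ)}

theorem IsWord.exists_list (hext : ∀ i b, EA (j i b) = E i b) {i k : Fin 2} {n : ℕ} {a : A}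
    (ha : IsWord EA (fun i => (j i).range) i k n a) :
    ∃ (b : B i) (l : List (Σ i, B i)),
      ((⟨i, b⟩ : Σ i, B i) :: l).IsChain (fun x y => x.1 ≠ y.1) ∧
      (∀ x ∈ (⟨i, b⟩ : Σ i, B i) :: l, E x.1 x.2 = 0) ∧
      (((⟨i, b⟩ : Σ i, B i) :: l).map fun x => j x.1 x.2).prod = a := by
  induction ha with
  | @letter i a ha h0 =>
    obtain ⟨b, rfl⟩ := ha
    refine ⟨b, [], by simp, ?_, by simp⟩
    simpa [← hext] using h0
  | @cons i k n a w ha h0 _ ih =>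
    obtain ⟨b, rfl⟩ := ha
    obtain ⟨b', l, h1, h2, h3⟩ := ih
    refine ⟨b, ⟨i + 1, b'⟩ :: l, List.isChain_cons_cons.2 ⟨?_, h1⟩, ?_, ?_⟩
    · change i ≠ i + 1
      fin_cases i <;> simp
    · intro x hx
      rcases List.mem_cons.1 hx with rfl | hx
      · exact (hext _ _).symm.trans h0
      · exact h2 x hx
    · rw [List.map_cons, List.prod_cons, h3]
      rfl

theorem IsReducedAmalgamatedFreeProduct.freePair
    (hA : IsReducedAmalgamatedFreeProduct ι E κ j EA) {tr : ∀ i, B i →ₗ[ℂ] ℂ}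
    (htr : ∀ i, IsFaithfulTrace (tr i)) (htr_proj : ∀ i k, tr i (ι i (minProj k)) = 1)
    (htrE : ∀ i b, tr i (ι i (E i b)) = tr i b) :
    FreePair κ EA fun i => (j i).range where
  incl_mem i d := ⟨ι i d, hA.agree i d⟩
  apply_incl := hA.condExp.apply_incl
  bimodule := hA.condExp.bimodule
  star_apply := hA.condExp.star_apply
  expect_word ha := by
    obtain ⟨b, l, h1, h2, rfl⟩ := ha.exists_list hA.extends_expectation
    exact hA.free _ (List.cons_ne_nil _ _) h1 h2
  tracial i := by
    -- The normalisation of `tr i` on the minimal projections enters here: a trace-preserving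
    -- expectation then recovers the trace as the unweighted sum of its coordinates.
    have h1 : ∀ b, ∑ k, E i b k = tr i b := by
      intro b
      have h2 : E i b = ∑ k, E i b k • minProj k := by
        ext l
        simp [minProj, Pi.single_apply]
      rw [← htrE]
      nth_rewrite 2 [h2]
      simp [htr_proj]
    rintro _ ⟨b, rfl⟩ _ ⟨c, rfl⟩
    change ∑ k, EA (j i b * j i c) k = ∑ k, EA (j i c * j i b) k
    rw [← map_mul, ← map_mul, hA.extends_expectation, hA.extends_expectation, h1, h1,
      (htr i).tracial]

/-- On each diagonal block both sides multiply by the same scalar `d k`. -/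
theorem incl_comm_of_eq_sum {B : Type*} [CStarAlgebra B] {ι : (Fin 2 → ℂ) →⋆ₐ[ℂ] B} {u : B}
    (hu : u = ∑ k, ι (minProj k) * u * ι (minProj k)) (d : Fin 2 → ℂ) : ι d * u = u * ι d := by
  have h1 : ∀ k, d * minProj k = d k • minProj k := by
    intro k; ext l
    by_cases h : l = k
    · subst h; simp [minProj]
    · simp [minProj, h]
  have h2 : ∀ k, ι d * ι (minProj k) = d k • ι (minProj k) := fun k => by
    rw [← map_mul, h1, map_smul]
  have h3 : ∀ k, ι (minProj k) * ι d = d k • ι (minProj k) := fun k => by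
    rw [← map_mul, mul_comm, h1, map_smul]
  rw [hu, Finset.mul_sum, Finset.sum_mul]
  refine Finset.sum_congr rfl fun k _ => ?_
  rw [← mul_assoc, ← mul_assoc, h2, mul_assoc _ _ (ι d), h3]
  simp

theorem IsReducedAmalgamatedFreeProduct.diagUnitary
    (hA : IsReducedAmalgamatedFreeProduct ι E κ j EA) {i : Fin 2} {u : B i}
    (hu : u ∈ unitary (B i)) (hdiag : u = ∑ k, ι i (minProj k) * u * ι i (minProj k))
    (hE : E i u = 0) : DiagUnitary κ EA (fun i => (j i).range) i (j i u) where
  mem := ⟨u, rfl⟩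
  expect := by rw [hA.extends_expectation, hE]
  star_mul_self := by rw [← map_star, ← map_mul, hu.1, map_one]
  mul_star_self := by rw [← map_star, ← map_mul, hu.2, map_one]
  comm d := by rw [← hA.agree i, ← map_mul, ← map_mul, incl_comm_of_eq_sum hdiag]

end FreeProduct

end AmalgFree

theorem mainTheorem4
    -- the separable unital C⋆-algebras `B 0`, `B 1`, both containing `D = ℂ²`
    (B : Fin 2 → Type*) [∀ i, CStarAlgebra (B i)]
    [∀ i, TopologicalSpace.SeparableSpace (B i)]
    (ι : ∀ i, (Fin 2 → ℂ) →⋆ₐ[ℂ] B i)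
    -- the traces, with value 1 on both minimal projections of `D`
    (tr : ∀ i, B i →ₗ[ℂ] ℂ) (htr : ∀ i, AmalgFree.IsFaithfulTrace (tr i))
    (htr_proj : ∀ i k, tr i (ι i (AmalgFree.minProj k)) = 1)
    -- the trace preserving conditional expectations onto `D`
    (E : ∀ i, B i →ₗ[ℂ] (Fin 2 → ℂ))
    (hE : ∀ i, AmalgFree.IsConditionalExpectation (ι i) (E i))
    (htrE : ∀ i b, tr i (ι i (E i b)) = tr i b)
    -- the reduced amalgamated free product `(A, EA) = (B 0, E 0) *_D (B 1, E 1)`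
    {A : Type*} [CStarAlgebra A] (κ : (Fin 2 → ℂ) →⋆ₐ[ℂ] A) (j : ∀ i, B i →⋆ₐ[ℂ] A)
    (EA : A →ₗ[ℂ] (Fin 2 → ℂ))
    (hA : AmalgFree.IsReducedAmalgamatedFreeProduct ι E κ j EA)
    -- the unitaries
    (u₁ : B 0) (u₂ u₂' : B 1)
    (hu₁ : u₁ ∈ unitary (B 0)) (hu₂ : u₂ ∈ unitary (B 1)) (hu₂' : u₂' ∈ unitary (B 1))
    (hdiag₁ : u₁ = ∑ k, ι 0 (AmalgFree.minProj k) * u₁ * ι 0 (AmalgFree.minProj k))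
    (hdiag₂ : u₂ = ∑ k, ι 1 (AmalgFree.minProj k) * u₂ * ι 1 (AmalgFree.minProj k))
    (hdiag₂' : u₂' = ∑ k, ι 1 (AmalgFree.minProj k) * u₂' * ι 1 (AmalgFree.minProj k))
    (hE₁ : E 0 u₁ = 0) (hE₂ : E 1 u₂ = 0) (hE₂' : E 1 u₂' = 0)
    (hE₂₂ : E 1 (star u₂ * u₂') = 0) :
    ∀ k, AmalgFree.HasStableRankOne (AmalgFree.minCorner κ k) := by
  intro k
  refine (hA.freePair htr htr_proj htrE).hasStableRankOne hA.condExp ?_ hA.faithful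
    (hA.diagUnitary hu₁ hdiag₁ hE₁) (hA.diagUnitary hu₂ hdiag₂ hE₂)
    (hA.diagUnitary hu₂' hdiag₂' hE₂') ?_ k
  · exact hA.generates
  · rw [← map_star, ← map_mul, hA.extends_expectation, hE₂₂]
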